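/- Let $K$ be a field, $S=K[x_1,\dots,x_n]$, and let $M\subseteq S$ be a monomial ideal with (finite) minimal set of monomial generators $G$. An element $m\in G$ is dominant in $G$ if there is a variable $x$ whose exponent in $m$ is strictly larger than its exponent in every $m'\in G\setminus\{m\}$; otherwise $m$ is nondominant. $M$ is dominant if all elements of $G$ are dominant (in particular $M=0$ is dominant), and a nonzero $M$ is purely nondominant if all elements of $G$ are nondominant. Write $G=\{m_1,\dots,m_q,n_1,\dots,n_p\}$ with the $m_i$ dominant and the $n_i$ nondominant. If $p>0$, let $C$ be the set of all pairs $(j,m)$ with $m=\operatorname{lcm}(m_{r_1},\dots,m_{r_j})$, $1\le r_1<\dots<r_j\le q$, $0\le j\le q$ (the case $j=0$ giving $(0,1)$), and for $(j,m)\in C$ let $M_m$ be the ideal generated by the monomials $\operatorname{lcm}(m,n_i)/m$, $1\le i\le p$. If $p=0$, let $C=\{(0,1)\}$ and $M_1=M$. The family of summands $\beta_{k-j,\,l/m}(S/M_m)$, $(j,m)\in C$, is the first structural decomposition of $M$. The second structural decomposition of $M$ is obtained by applying the first structural decomposition $p$ times in succession, i.e. to $M$, then to each of the resulting ideals, and so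 on; its summands are $$\beta_{k-j_1-\dots-j_p,\;l/(l_1\cdots l_p)}(S/M_{l_1,\dots,l_p}),$$ where each ideal $M_{l_1,\dots,l_p}$ is either dominant or purely nondominant. Its purely nondominant part consists of the summands whose ideal is purely nondominant. The multigraded Betti number $\beta_{k,l}(S/M)$ is the number of basis elements of multidegree $l$ in homological degree $k$ of a minimal multigraded free resolution of $S/M$ by free modules of finite rank; here a resolution is minimal if no entry of its differential matrices is invertible. A Taylor symbol of $M$ is a subset of $G$, and its multidegree is the least common multiple of its elements (the empty set has multidegree $1$). **Theorem.** Suppose that the second structural decomposition of $M$ has no purely nondominant part. Then $M$ has characteristic Betti numbers: $S/M$ has a minimal multigraded free resolution, and for every such resolution and every monomial $l$, only finitely many of the numbers $\beta_{k,l}(S/M)$, $k\ge 0$, are nonzero and $$\sum_k \beta_{k,l}(S/M)=\begin{cases}1 & \text{if the number of Taylor symbols of } M \text{ of multidegree } l \text{ is odd},\\ 0 & \text{otherwise.}\end{cases}$$ -/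

import Mathlib

namespace MonomialIdeal

open MvPolynomial

/-! Monomials of `S = K[x₁, …, xₙ]` are represented by their exponent vectors `a : Fin n →₀ ℕ`:
the monomial is `monomial a 1`, divisibility is `≤`, the product is `+`, the least common multiple
is `⊔`, the quotient of a monomial by one of its divisors is `-`, and the monomial `1` is `0`. -/

section Generators

variable {K : Type*} [Field K] {n : ℕ}

/-- The ideal of `K[x₁, …, xₙ]` generated by a set of monomials. -/
noncomputable def ofMonomials (K : Type*) [Field K] {n : ℕ} (A : Set (Fin n →₀ ℕ)) :
    Ideal (MvPolynomial (Fin n) K) :=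
  Ideal.span ((fun a => monomial a (1 : K)) '' A)

/-- `M` is a monomial ideal: it is generated by monomials. -/
def IsMonomialIdeal (M : Ideal (MvPolynomial (Fin n) K)) : Prop :=
  ∃ A : Set (Fin n →₀ ℕ), M = ofMonomials K A

theorem finite_minimal (M : Ideal (MvPolynomial (Fin n) K)) :
    {a : Fin n →₀ ℕ | Minimal (fun b => monomial b (1 : K) ∈ M) a}.Finite :=
  WellQuasiOrderedLE.finite_of_isAntichain (setOfPred_minimal_antichain _)

/-- The minimal generating set `G` of a monomial ideal `M`: the monomials of `M` that are
minimal with respect to divisibility. -/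
noncomputable def minGens (M : Ideal (MvPolynomial (Fin n) K)) : Finset (Fin n →₀ ℕ) :=
  (finite_minimal M).toFinset

/-- The Taylor symbols of `𝕋_M` (the basis of the Taylor resolution on the minimal generating
set): the subsets of `minGens M`. -/
noncomputable def taylorSymbols (M : Ideal (MvPolynomial (Fin n) K)) :
    Finset (Finset (Fin n →₀ ℕ)) :=
  (minGens M).powerset

/-- The multidegree of a Taylor symbol: the least common multiple of its monomials. -/
noncomputable def mdeg {n : ℕ} (s : Finset (Fin n →₀ ℕ)) : Fin n →₀ ℕ := s.sup id

open scoped Classical in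
/-- The number of Taylor symbols of `𝕋_M` of multidegree `l`. -/
noncomputable def taylorCount (M : Ideal (MvPolynomial (Fin n) K)) (l : Fin n →₀ ℕ) : ℕ :=
  ((taylorSymbols M).filter fun s => mdeg s = l).card

end Generators

section Decomposition

variable {K : Type*} [Field K] {n : ℕ}

/-- `m` is dominant in `G`: some variable `x` appears in `m` with a larger exponent than in every
other element of `G`. -/
def IsDominantIn {n : ℕ} (G : Finset (Fin n →₀ ℕ)) (m : Fin n →₀ ℕ) : Prop :=
  ∃ x : Fin n, ∀ m' ∈ G, m' ≠ m → m' x < m x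

open scoped Classical in
/-- The dominant minimal generators of `M`. -/
noncomputable def domGens (M : Ideal (MvPolynomial (Fin n) K)) : Finset (Fin n →₀ ℕ) :=
  (minGens M).filter fun m => IsDominantIn (minGens M) m

open scoped Classical in
/-- The nondominant minimal generators of `M`. -/
noncomputable def nondomGens (M : Ideal (MvPolynomial (Fin n) K)) : Finset (Fin n →₀ ℕ) :=
  (minGens M).filter fun m => ¬ IsDominantIn (minGens M) m

/-- `M` is dominant: all its minimal generators are dominant. -/
def IsDominant (M : Ideal (MvPolynomial (Fin n) K)) : Prop :=
  ∀ m ∈ minGens M, IsDominantIn (minGens M) m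

/-- `M` is purely nondominant: all its minimal generators are nondominant. -/
def IsPurelyNondominant (M : Ideal (MvPolynomial (Fin n) K)) : Prop :=
  ∀ m ∈ minGens M, ¬ IsDominantIn (minGens M) m

open scoped Classical in
/-- The index set `C` of the first structural decomposition of `M`: if `M` has a nondominant
generator, the pairs `(j, m)` such that `m` is the least common multiple of `j` dominant generators
(the pair `(0, 1)` comes from the empty set); otherwise only `(0, 1)`. -/
noncomputable def firstIndex (M : Ideal (MvPolynomial (Fin n) K)) :
    Finset (ℕ × (Fin n →₀ ℕ)) :=
  if nondomGens M = ∅ then {(0, 0)}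
  else (domGens M).powerset.image fun A => (A.card, mdeg A)

open scoped Classical in
/-- The ideal `M_m` of the first structural decomposition: if `M` has nondominant generators
`h₁, …, h_c` with `c > 0`, it is generated by the monomials `lcm(m, hᵢ) / m`;
if there are none, it is `M`. -/
noncomputable def firstIdeal (M : Ideal (MvPolynomial (Fin n) K)) (m : Fin n →₀ ℕ) :
    Ideal (MvPolynomial (Fin n) K) :=
  if nondomGens M = ∅ then M
  else ofMonomials K ((fun h => (m ⊔ h) - m) '' (nondomGens M : Set (Fin n →₀ ℕ)))

/-- A summand `β_{k - shift, l / mon}(S / ideal)` of a structural decomposition. -/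
structure Summand (K : Type*) [Field K] (n : ℕ) where
  shift : ℕ
  mon : Fin n →₀ ℕ
  ideal : Ideal (MvPolynomial (Fin n) K)

/-- Replace `β_{k - j, l / m}(S / N)` by the summands that the first structural decomposition of
`N` gives. An ideal `N` that is dominant or purely nondominant is only replaced by itself, with
index `(0, 1)`. -/
noncomputable def Summand.refine (T : Summand K n) : Multiset (Summand K n) :=
  (firstIndex T.ideal).val.map fun p => ⟨T.shift + p.1, T.mon + p.2, firstIdeal T.ideal p.2⟩

/-- The first structural decomposition of `M`. -/
noncomputable def firstDecomposition (M : Ideal (MvPolynomial (Fin n) K)) :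
    Multiset (Summand K n) :=
  Summand.refine ⟨0, 0, M⟩

/-- The second structural decomposition of `M`, with summands
`β_{k - j₁ - ⋯ - j_p, l / (l₁ ⋯ l_p)}(S / M_{l₁, …, l_p})`: the first structural
decomposition is applied `p` times in succession, where `p` is the number of nondominant
generators of `M`; after that each ideal is dominant or purely nondominant. -/
noncomputable def secondDecomposition (M : Ideal (MvPolynomial (Fin n) K)) :
    Multiset (Summand K n) :=
  (fun D : Multiset (Summand K n) => D.bind Summand.refine)^[(nondomGens M).card] {⟨0, 0, M⟩}

open scoped Classical in
/-- The summands with purely nondominant ideals. (The zero ideal, which has no minimal generators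
and so satisfies both definitions, is counted as dominant.) -/
noncomputable def purelyNondominantPart (M : Ideal (MvPolynomial (Fin n) K)) :
    Multiset (Summand K n) :=
  (secondDecomposition M).filter fun T => IsPurelyNondominant T.ideal ∧ ¬ IsDominant T.ideal

end Decomposition

section Resolutions

variable {K : Type*} [Field K] {n : ℕ}

/-- A multigraded free resolution `⋯ → F₂ → F₁ → F₀ → S/M → 0` by free modules of finite rank,
given with homogeneous bases: `Fᵢ` is free on `basis i`, a basis element `b` has multidegree
`mdeg i b`, and all maps preserve multidegrees. `diff i` is the map `F_{i+1} → F_i`. -/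
structure FreeResolution (M : Ideal (MvPolynomial (Fin n) K)) where
  basis : ℕ → Type
  finite_basis : ∀ i, Finite (basis i)
  mdeg : ∀ i, basis i → (Fin n →₀ ℕ)
  diff : ∀ i, (basis (i + 1) →₀ MvPolynomial (Fin n) K) →ₗ[MvPolynomial (Fin n) K]
    (basis i →₀ MvPolynomial (Fin n) K)
  aug : (basis 0 →₀ MvPolynomial (Fin n) K) →ₗ[MvPolynomial (Fin n) K]
    (MvPolynomial (Fin n) K ⧸ M)
  /-- The matrix entry at `(c, b)` is a scalar multiple of the monomial
  `mdeg b / mdeg c`, and is zero if `mdeg c` does not divide `mdeg b`. -/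
  diff_homogeneous : ∀ i (b : basis (i + 1)) (c : basis i),
    ∃ (e : Fin n →₀ ℕ) (r : K), diff i (Finsupp.single b 1) c = monomial e r ∧
      (r ≠ 0 → mdeg i c + e = mdeg (i + 1) b)
  aug_homogeneous : ∀ b : basis 0, ∃ r : K,
    aug (Finsupp.single b 1) = Ideal.Quotient.mk M (monomial (mdeg 0 b) r)
  aug_surjective : Function.Surjective aug
  exact_zero : Function.Exact (diff 0) aug
  exact_succ : ∀ i, Function.Exact (diff (i + 1)) (diff i)

/-- The resolution is minimal: no entry of a differential matrix is invertible. -/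
def FreeResolution.IsMinimal {M : Ideal (MvPolynomial (Fin n) K)} (F : FreeResolution M) : Prop :=
  ∀ i (b : F.basis (i + 1)) (c : F.basis i), ¬ IsUnit (F.diff i (Finsupp.single b 1) c)

/-- The number of basis elements of `F_k` of multidegree `l`. If `F` is minimal, this is the
multigraded Betti number `β_{k,l}(S/M)`. -/
noncomputable def FreeResolution.betti {M : Ideal (MvPolynomial (Fin n) K)} (F : FreeResolution M)
    (k : ℕ) (l : Fin n →₀ ℕ) : ℕ :=
  Nat.card {b : F.basis k // F.mdeg k b = l}

open scoped Classical in
/-- `M` has characteristic Betti numbers: for each monomial `l`, the sum `∑ₖ β_{k,l}(S/M)` (which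
has only finitely many nonzero terms) is `1` if the number of Taylor symbols of `𝕋_M` of
multidegree `l` is odd, and `0` otherwise. The Betti numbers may be read off from any minimal
resolution, and there is one. -/
def HasCharacteristicBettiNumbers (M : Ideal (MvPolynomial (Fin n) K)) : Prop :=
  (∃ F : FreeResolution M, F.IsMinimal) ∧
    ∀ F : FreeResolution M, F.IsMinimal → ∀ l : Fin n →₀ ℕ,
      HasSum (fun k => F.betti k l) (if Odd (taylorCount M l) then 1 else 0)

end Resolutions

end MonomialIdeal

namespace MonomialIdeal

open Finsupp

/-! ### Chains supported on a set of basis elements -/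

section Supported

variable {K : Type*} [Field K] {X Y : Type*}

/-! The count of basis elements of multidegree `l` is governed by the strand at `l`: the part of a
resolution in multidegrees dividing `l`, modulo the part in proper divisors of `l`. Call a
resolution cyclic at `l` if the homology of this strand, taken over all homological degrees
together, is spanned by one class. In a minimal resolution the strand has zero differential, so
cyclicity leaves at most one basis element of multidegree `l` (`fiber_subsingleton`).

Pairs of basis elements of equal multidegree joined by a nonzero scalar entry can be cancelled from
the Taylor resolution until it is minimal (`exists_isMinimal`). Each cancellation preserves
cyclicity and removes two or no basis elements of multidegree `l`, so the parity of their number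
stays that of the number of Taylor symbols. It remains to show that the Taylor resolution is cyclic
at every `l`.

This follows the structural decomposition (`lcmCyclic_of_refineAll`). Subsets of `A`, with
multidegree the lcm with a fixed `m`, form up to a shift by `m` the Taylor complex on the quotients
`lcm (m, f a) / m`. Redundant generators can be dropped, and the strand is acyclic if some quotient
is 1. By dominance, the multidegree `l` determines which dominant generators a symbol contains.
Absorbing these into `m` leaves the strand of the nondominant generators, that is, of a summand of
the first decomposition (`lcmCyclic_of_inter_eq`). Repeating this ends in a dominant ideal, where at
most one symbol has multidegree `l`: a purely nondominant, not dominant ideal met on the way would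
persist to the end, against the hypothesis.

Finally, two minimal resolutions have equally many basis elements in each degree
(`card_le_of_isMinimal`). The argument is carried out on scalar matrices, and multigraded components
translate to and from free modules over the polynomial ring. -/

theorem map_mem_of_supported {W : Type*} [AddCommGroup W] [Module K W] {f : (X →₀ K) →ₗ[K] W}
    {s : Set X} {N : Submodule K W} (h : ∀ b ∈ s, f (single b 1) ∈ N) {v : X →₀ K}
    (hv : v ∈ supported K K s) : f v ∈ N := by
  rw [supported_eq_span_single] at hv
  have : Submodule.span K ((fun i => single i (1 : K)) '' s) ≤ N.comap f := by
    rw [Submodule.span_le]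
    rintro _ ⟨b, hb, rfl⟩
    exact h b hb
  exact this hv

theorem eqOn_supported {W : Type*} [AddCommGroup W] [Module K W] {f g : (X →₀ K) →ₗ[K] W}
    {s : Set X} (h : ∀ b ∈ s, f (single b 1) = g (single b 1)) {v : X →₀ K}
    (hv : v ∈ supported K K s) : f v = g v := by
  have := map_mem_of_supported (f := f - g) (N := ⊥) (fun b hb => by simp [h b hb]) hv
  simpa [sub_eq_zero] using this

theorem apply_eq_zero_of_supported {s : Set X} {v : X →₀ K} (hv : v ∈ supported K K s) {b : X}
    (hb : b ∉ s) : v b = 0 :=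
  (mem_supported' K v).1 hv b hb

/-- The homology of the quotient of the subcomplex spanned by `L` by the subcomplex spanned by
`L'` is generated by one element. -/
def HomologyCyclic (d : (X →₀ K) →ₗ[K] (X →₀ K)) (L L' : Set X) : Prop :=
  ∃ v, ∀ z ∈ supported K K L, d z ∈ supported K K L' →
    ∃ c : K, ∃ y ∈ supported K K L, z - c • v - d y ∈ supported K K L'

end Supported

/-! ### Signed insertion and deletion; the boundary of a simplex -/

section Koszul

variable {K : Type*} [Field K] {ι : Type*} [LinearOrder ι]

/-- The sign of `g` relative to `s`. -/
def koszulSign (K : Type*) [Field K] (g : ι) (s : Finset ι) : K :=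
  (-1) ^ (s.filter (· < g)).card

theorem koszulSign_mul_self (g : ι) (s : Finset ι) :
    koszulSign K g s * koszulSign K g s = 1 := by
  unfold koszulSign
  rw [← mul_pow]; simp

theorem koszulSign_insert {g h : ι} {s : Finset ι} (hs : h ∉ s) :
    koszulSign K g (insert h s) = if h < g then -koszulSign K g s else koszulSign K g s := by
  unfold koszulSign
  rw [Finset.filter_insert]
  split_ifs with hg
  · rw [Finset.card_insert_of_notMem (by simp [hs]), pow_succ]; ring
  · rfl

theorem koszulSign_erase {g h : ι} {s : Finset ι} (hs : h ∈ s) :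
    koszulSign K g (s.erase h) = if h < g then -koszulSign K g s else koszulSign K g s := by
  conv_rhs => rw [← Finset.insert_erase hs]
  rw [koszulSign_insert (Finset.notMem_erase h s)]
  split_ifs <;> simp

/-- Signed removal of `g`. -/
noncomputable def del (K : Type*) [Field K] (g : ι) : (Finset ι →₀ K) →ₗ[K] (Finset ι →₀ K) :=
  linearCombination K fun s => if g ∈ s then single (s.erase g) (koszulSign K g s) else 0

/-- Signed insertion of `g`. -/
noncomputable def ins (K : Type*) [Field K] (g : ι) : (Finset ι →₀ K) →ₗ[K] (Finset ι →₀ K) :=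
  linearCombination K fun s => if g ∈ s then 0 else single (insert g s) (koszulSign K g s)

theorem del_single (g : ι) (s : Finset ι) (r : K) :
    del K g (single s r) =
      if g ∈ s then single (s.erase g) (r * koszulSign K g s) else 0 := by
  rw [del, linearCombination_single]; split_ifs <;> simp

theorem ins_single (g : ι) (s : Finset ι) (r : K) :
    ins K g (single s r) =
      if g ∈ s then 0 else single (insert g s) (r * koszulSign K g s) := by
  rw [ins, linearCombination_single]; split_ifs <;> simp

theorem del_del_self (g : ι) (v : Finset ι →₀ K) : del K g (del K g v) = 0 := by
  have : del K g ∘ₗ del K g = 0 := by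
    ext1 s; ext1
    simp only [LinearMap.comp_apply, lsingle_apply, del_single]
    split_ifs <;> simp [del_single]
  exact LinearMap.congr_fun this v

theorem del_del (g h : ι) (v : Finset ι →₀ K) :
    del K g (del K h v) = -del K h (del K g v) := by
  rcases eq_or_ne g h with rfl | hgh
  · simp [del_del_self]
  have : del K g ∘ₗ del K h = -(del K h ∘ₗ del K g) := by
    ext1 s; ext1
    simp only [LinearMap.comp_apply, lsingle_apply, LinearMap.neg_apply, del_single]
    by_cases h1 : g ∈ s <;> by_cases h2 : h ∈ s <;>
      simp [h1, h2, del_single, hgh, hgh.symm]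
    rw [koszulSign_erase h1, koszulSign_erase h2, Finset.erase_right_comm, ← single_mul, ← single_mul, ← single_neg]
    congr 1
    rcases lt_or_gt_of_ne hgh with h3 | h3 <;> simp [h3, h3.not_gt] <;> ring
  exact LinearMap.congr_fun this v

theorem ins_del {g h : ι} (hgh : g ≠ h) (v : Finset ι →₀ K) :
    ins K g (del K h v) = -del K h (ins K g v) := by
  have : ins K g ∘ₗ del K h = -(del K h ∘ₗ ins K g) := by
    ext1 s; ext1
    simp only [LinearMap.comp_apply, lsingle_apply, LinearMap.neg_apply, del_single, ins_single]
    by_cases h1 : g ∈ s <;> by_cases h2 : h ∈ s <;>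
      simp [h1, h2, del_single, ins_single, hgh, hgh.symm]
    rw [koszulSign_erase h2, koszulSign_insert h1, Finset.erase_insert_of_ne hgh, ← single_mul, ← single_mul,
      ← single_neg]
    congr 1
    rcases lt_or_gt_of_ne hgh with h3 | h3 <;> simp [h3, h3.not_gt] <;> ring
  exact LinearMap.congr_fun this v

theorem del_ins_add_ins_del (g : ι) (v : Finset ι →₀ K) :
    del K g (ins K g v) + ins K g (del K g v) = v := by
  have : del K g ∘ₗ ins K g + ins K g ∘ₗ del K g = LinearMap.id := by
    ext1 s; ext1
    simp only [LinearMap.comp_apply, lsingle_apply, LinearMap.add_apply, del_single, ins_single]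
    by_cases h1 : g ∈ s
    · simp [h1, ins_single, koszulSign_erase, koszulSign_mul_self]
    · simp [h1, del_single, koszulSign_insert, koszulSign_mul_self]
  exact LinearMap.congr_fun this v

theorem del_mem_supported {g : ι} {L L' : Set (Finset ι)}
    (h : ∀ s ∈ L, g ∈ s → s.erase g ∈ L') {v : Finset ι →₀ K} (hv : v ∈ supported K K L) :
    del K g v ∈ supported K K L' := by
  refine map_mem_of_supported (fun s hs => ?_) hv
  rw [del_single]
  split_ifs with hg
  · exact single_mem_supported K _ (h s hs hg)
  · exact Submodule.zero_mem _

theorem ins_mem_supported {g : ι} {L L' : Set (Finset ι)}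
    (h : ∀ s ∈ L, g ∉ s → insert g s ∈ L') {v : Finset ι →₀ K} (hv : v ∈ supported K K L) :
    ins K g v ∈ supported K K L' := by
  refine map_mem_of_supported (fun s hs => ?_) hv
  rw [ins_single]
  split_ifs with hg
  · exact Submodule.zero_mem _
  · exact single_mem_supported K _ (h s hs hg)

variable [Fintype ι]

/-- The boundary of the full simplex on `ι`, augmented. -/
noncomputable def bd (K : Type*) [Field K] (ι : Type*) [LinearOrder ι] [Fintype ι] :
    (Finset ι →₀ K) →ₗ[K] (Finset ι →₀ K) :=
  ∑ g, del K g

theorem bd_bd (v : Finset ι →₀ K) : bd K ι (bd K ι v) = 0 := by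
  simp only [bd, LinearMap.sum_apply, map_sum]
  rw [← Finset.sum_product']
  -- The terms of `(g, h)` and `(h, g)` cancel by anticommutativity. The diagonal terms vanish by
  -- themselves, which covers characteristic two.
  refine Finset.sum_involution (fun p _ => (p.2, p.1)) ?_ ?_ (by simp) (by simp)
  · rintro ⟨g, h⟩ -
    simp [del_del g h]
  · rintro ⟨g, h⟩ - h1 h2
    simp only [Prod.mk.injEq] at h2
    obtain ⟨rfl, -⟩ := h2
    exact h1 (del_del_self _ _)

theorem bd_del (g : ι) (v : Finset ι →₀ K) : bd K ι (del K g v) = -del K g (bd K ι v) := by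
  simp only [bd, LinearMap.sum_apply, map_sum]
  rw [← Finset.sum_neg_distrib]
  exact Finset.sum_congr rfl fun h _ => del_del h g v

/-- The homotopy formula: `ins K g` contracts the augmented simplex, and it contracts every strand
that it maps to itself. -/
theorem bd_ins (g : ι) (v : Finset ι →₀ K) : bd K ι (ins K g v) = v - ins K g (bd K ι v) := by
  simp only [bd, LinearMap.sum_apply, map_sum]
  rw [eq_sub_iff_add_eq, ← Finset.sum_add_distrib, Finset.sum_eq_single g]
  · exact del_ins_add_ins_del g v
  · intro h _ hg
    rw [ins_del hg.symm, add_neg_cancel]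
  · simp

theorem bd_single_mem {N : Submodule K (Finset ι →₀ K)} (s : Finset ι)
    (h : ∀ g ∈ s, single (s.erase g) 1 ∈ N) : bd K ι (single s 1) ∈ N := by
  rw [bd, LinearMap.sum_apply]
  refine Submodule.sum_mem _ fun g _ => ?_
  rw [del_single]
  split_ifs with hg
  · rw [← mul_one (1 * koszulSign K g s), ← smul_eq_mul, ← smul_single]
    exact N.smul_mem _ (h g hg)
  · exact N.zero_mem

theorem bd_mem_supported {L L' : Set (Finset ι)}
    (h : ∀ s ∈ L, ∀ g ∈ s, s.erase g ∈ L') {v : Finset ι →₀ K} (hv : v ∈ supported K K L) :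
    bd K ι v ∈ supported K K L' :=
  map_mem_of_supported
    (fun s hs => bd_single_mem s fun g hg => single_mem_supported K _ (h s hs g hg)) hv

end Koszul

/-! ### Cyclicity of the strands of lcm complexes -/

section Families

variable {K : Type*} [Field K] {ι : Type*} {n : ℕ}

/-- The sets of members of `A` whose least common multiple together with `m` divides `l`. -/
def lcmDvd (f : ι → Fin n →₀ ℕ) (A : Finset ι) (m l : Fin n →₀ ℕ) : Set (Finset ι) :=
  {s | s ⊆ A ∧ m ⊔ s.sup f ≤ l}

/-- The sets of members of `A` whose least common multiple together with `m` is a proper divisor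
of `l`. -/
def lcmSDvd (f : ι → Fin n →₀ ℕ) (A : Finset ι) (m l : Fin n →₀ ℕ) : Set (Finset ι) :=
  {s | s ⊆ A ∧ m ⊔ s.sup f < l}

variable {f : ι → Fin n →₀ ℕ} {A : Finset ι} {m l : Fin n →₀ ℕ}

theorem lcmDvd_mono {B : Finset ι} (h : A ⊆ B) : lcmDvd f A m l ⊆ lcmDvd f B m l :=
  fun _ hs => ⟨hs.1.trans h, hs.2⟩

theorem lcmSDvd_mono {B : Finset ι} (h : A ⊆ B) : lcmSDvd f A m l ⊆ lcmSDvd f B m l :=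
  fun _ hs => ⟨hs.1.trans h, hs.2⟩

theorem mem_lcmSDvd_of_ne {s : Finset ι} (hs : s ∈ lcmDvd f A m l) (h : m ⊔ s.sup f ≠ l) :
    s ∈ lcmSDvd f A m l :=
  ⟨hs.1, lt_of_le_of_ne hs.2 h⟩

variable [LinearOrder ι]

theorem sup_erase_le (s : Finset ι) (g : ι) : m ⊔ (s.erase g).sup f ≤ m ⊔ s.sup f :=
  sup_le_sup_left (Finset.sup_mono (Finset.erase_subset g s)) m

theorem erase_mem_lcmDvd {s : Finset ι} (g : ι) (hs : s ∈ lcmDvd f A m l) :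
    s.erase g ∈ lcmDvd f A m l :=
  ⟨(Finset.erase_subset g s).trans hs.1, (sup_erase_le s g).trans hs.2⟩

theorem erase_mem_lcmSDvd {s : Finset ι} (g : ι) (hs : s ∈ lcmSDvd f A m l) :
    s.erase g ∈ lcmSDvd f A m l :=
  ⟨(Finset.erase_subset g s).trans hs.1, (sup_erase_le s g).trans_lt hs.2⟩

theorem sup_sup_insert (s : Finset ι) (g : ι) :
    m ⊔ (insert g s).sup f = (m ⊔ f g) ⊔ s.sup f := by
  rw [Finset.sup_insert, sup_assoc]

theorem sup_insert_of_le {s : Finset ι} {g : ι} (h : f g ≤ m ⊔ s.sup f) :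
    m ⊔ (insert g s).sup f = m ⊔ s.sup f := by
  rw [Finset.sup_insert, sup_left_comm, sup_eq_right.2 h]

/-- Deleting and reinserting `g` is the projection onto the faces that contain `g`, so the
difference keeps the other faces. -/
theorem sub_ins_del_mem_supported {L : Set (Finset ι)} (g : ι) {v : Finset ι →₀ K}
    (hv : v ∈ supported K K L) :
    v - ins K g (del K g v) ∈ supported K K {s | s ∈ L ∧ g ∉ s} := by
  change (LinearMap.id - ins K g ∘ₗ del K g : (Finset ι →₀ K) →ₗ[K] (Finset ι →₀ K)) v ∈ _
  refine map_mem_of_supported (fun s hs => ?_) hv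
  simp only [LinearMap.sub_apply, LinearMap.id_apply, LinearMap.comp_apply, del_single]
  split_ifs with hg
  · rw [ins_single, if_neg (Finset.notMem_erase g s), Finset.insert_erase hg, koszulSign_erase hg,
      if_neg (lt_irrefl g), one_mul, koszulSign_mul_self, sub_self]
    exact Submodule.zero_mem _
  · rw [map_zero, sub_zero]
    exact single_mem_supported K _ ⟨hs, hg⟩

theorem ins_del_mem_supported {L : Set (Finset ι)} (g : ι) {v : Finset ι →₀ K}
    (hv : v ∈ supported K K L) : ins K g (del K g v) ∈ supported K K {s | s ∈ L ∧ g ∈ s} := by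
  refine ins_mem_supported (L := {s | g ∉ s ∧ insert g s ∈ L}) ?_ (del_mem_supported ?_ hv)
  · rintro s ⟨hs, hs'⟩ _
    exact ⟨hs', Finset.mem_insert_self g s⟩
  · intro s hs hg
    exact ⟨Finset.notMem_erase g s, by rwa [Finset.insert_erase hg]⟩

variable [Fintype ι]

theorem bd_mem_lcmDvd {v : Finset ι →₀ K} (hv : v ∈ supported K K (lcmDvd f A m l)) :
    bd K ι v ∈ supported K K (lcmDvd f A m l) :=
  bd_mem_supported (fun _ hs g _ => erase_mem_lcmDvd g hs) hv

theorem bd_mem_lcmSDvd {v : Finset ι →₀ K} (hv : v ∈ supported K K (lcmSDvd f A m l)) :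
    bd K ι v ∈ supported K K (lcmSDvd f A m l) :=
  bd_mem_supported (fun _ hs g _ => erase_mem_lcmSDvd g hs) hv

/-- In multidegree `l`, the homology of the complex of subsets `s` of `A`, where `s` has multidegree
`lcm (m, f s)`, modulo smaller multidegrees, is generated by one element. -/
def LcmCyclic (K : Type*) [Field K] (f : ι → Fin n →₀ ℕ) (A : Finset ι) (m l : Fin n →₀ ℕ) :
    Prop :=
  HomologyCyclic (bd K ι) (lcmDvd f A m l) (lcmSDvd f A m l)

/-- Adjoining `g` to a face that contains `h` leaves its multidegree unchanged. Hence the part `z₁`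
of a chain on the faces containing `h` can be removed with the boundary of `ins K g z₁`, which
trades `h` for `g` up to smaller multidegrees. -/
theorem lcmCyclic_of_erase {g h : ι} (hg : g ∈ A) (hgh : g ≠ h) (hle : f g ≤ m ⊔ f h)
    (hc : LcmCyclic K f (A.erase h) m l) : LcmCyclic K f A m l := by
  obtain ⟨v, hv⟩ := hc
  refine ⟨v, fun z hz hdz => ?_⟩
  set z₁ := ins K h (del K h z) with hz₁
  have hle' : ∀ s : Finset ι, h ∈ s → m ⊔ (insert g s).sup f = m ⊔ s.sup f := fun s hs =>
    sup_insert_of_le (hle.trans (sup_le_sup_left (Finset.le_sup hs) m))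
  have hz₁m : z₁ ∈ supported K K {s | s ∈ lcmDvd f A m l ∧ h ∈ s} := ins_del_mem_supported h hz
  have hy : ins K g z₁ ∈ supported K K (lcmDvd f A m l) := by
    refine ins_mem_supported ?_ hz₁m
    rintro s ⟨hs, hhs⟩ -
    exact ⟨Finset.insert_subset hg hs.1, (hle' s hhs).trans_le hs.2⟩
  have hdz₁ : bd K ι z₁ = del K h z + ins K h (del K h (bd K ι z)) := by
    rw [hz₁, bd_ins, bd_del, map_neg, sub_neg_eq_add]
  have hsmall : ins K g (ins K h (del K h (bd K ι z))) ∈ supported K K (lcmSDvd f A m l) := by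
    refine ins_mem_supported ?_ (ins_del_mem_supported h hdz)
    rintro s ⟨hs, hhs⟩ -
    exact ⟨Finset.insert_subset hg hs.1, (hle' s hhs).trans_lt hs.2⟩
  have hdy : bd K ι (ins K g z₁) = z₁ - ins K g (del K h z) -
      ins K g (ins K h (del K h (bd K ι z))) := by
    rw [bd_ins, hdz₁, map_add]; abel
  -- This is `z` with `h` replaced by `g`: it is homologous to `z` modulo smaller multidegrees and
  -- no longer involves `h`.
  set w := z - z₁ + ins K g (del K h z) with hw
  have hwz : z - bd K ι (ins K g z₁) = w + ins K g (ins K h (del K h (bd K ι z))) := by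
    rw [hdy, hw]; abel
  have hwm : w ∈ supported K K (lcmDvd f (A.erase h) m l) := by
    refine Submodule.add_mem _ ?_ ?_
    · refine supported_mono ?_ (sub_ins_del_mem_supported h hz)
      rintro s ⟨hs, hhs⟩
      exact ⟨Finset.subset_erase.2 ⟨hs.1, hhs⟩, hs.2⟩
    · refine ins_mem_supported (L := {s | h ∉ s ∧ insert h s ∈ lcmDvd f A m l}) ?_
        (del_mem_supported ?_ hz)
      · rintro s ⟨hhs, hs⟩ -
        refine ⟨Finset.insert_subset (Finset.mem_erase.2 ⟨hgh, hg⟩)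
          (Finset.subset_erase.2 ⟨(Finset.subset_insert h s).trans hs.1, hhs⟩), ?_⟩
        refine le_trans ?_ hs.2
        rw [← hle' _ (Finset.mem_insert_self h s)]
        exact sup_le_sup_left (Finset.sup_mono
          (Finset.insert_subset_insert g (Finset.subset_insert h s))) m
      · intro s hs hhs
        exact ⟨Finset.notMem_erase h s, by rwa [Finset.insert_erase hhs]⟩
  have hdw : bd K ι w ∈ supported K K (lcmSDvd f (A.erase h) m l) := by
    have h1 : bd K ι w ∈ supported K K (lcmSDvd f A m l) := by
      have : bd K ι w = bd K ι z - bd K ι (ins K g (ins K h (del K h (bd K ι z)))) := by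
        rw [eq_sub_iff_add_eq, ← map_add, ← hwz, map_sub, bd_bd, sub_zero]
      rw [this]
      exact Submodule.sub_mem _ hdz (bd_mem_lcmSDvd hsmall)
    have h2 := bd_mem_lcmDvd hwm
    have h3 : bd K ι w ∈ supported K K (lcmSDvd f A m l) ⊓ supported K K
      (lcmDvd f (A.erase h) m l) := ⟨h1, h2⟩
    rw [← supported_inter] at h3
    exact supported_mono (fun s hs => (⟨hs.2.1, hs.1.2⟩ : s ∈ lcmSDvd f _ m l)) h3
  obtain ⟨c, y, hy', hc⟩ := hv w hwm hdw
  refine ⟨c, ins K g z₁ + y, Submodule.add_mem _ hy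
    (supported_mono (lcmDvd_mono (Finset.erase_subset h A)) hy'), ?_⟩
  have : z - c • v - bd K ι (ins K g z₁ + y) = (w - c • v - bd K ι y) +
      ins K g (ins K h (del K h (bd K ι z))) := by
    rw [map_add, ← sub_sub, sub_right_comm z, hwz]; abel
  rw [this]
  exact Submodule.add_mem _ (supported_mono (lcmSDvd_mono (Finset.erase_subset h A)) hc) hsmall

/-- The elements of `A` are adjoined to `B` one at a time; each new one is redundant because of an
element of `B`. -/
theorem lcmCyclic_of_subset {B : Finset ι} (hBA : B ⊆ A)
    (hB : ∀ h ∈ A, ∃ g ∈ B, f g ≤ m ⊔ f h) (hc : LcmCyclic K f B m l) : LcmCyclic K f A m l := by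
  suffices H : ∀ E : Finset ι, E ⊆ A → LcmCyclic K f (B ∪ E) m l by
    simpa [Finset.union_eq_right.2 hBA] using H A subset_rfl
  intro E
  induction E using Finset.induction_on with
  | empty => simpa using hc
  | insert h E hhE ih =>
    intro hE
    have ih' := ih ((Finset.subset_insert h E).trans hE)
    rw [Finset.union_insert]
    by_cases hm : h ∈ B ∪ E
    · rwa [Finset.insert_eq_of_mem hm]
    · obtain ⟨g, hgB, hg⟩ := hB h (hE (Finset.mem_insert_self h E))
      have hgm : g ∈ B ∪ E := Finset.mem_union_left E hgB
      refine lcmCyclic_of_erase (g := g) (h := h) (Finset.mem_insert_of_mem hgm) ?_ hg ?_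
      · rintro rfl; exact hm hgm
      · rwa [Finset.erase_insert hm]

/-- Adjoining `g` never changes a multidegree, so `ins K g` contracts the strand and the homology is
zero. -/
theorem lcmCyclic_of_le {g : ι} (hg : g ∈ A) (hle : f g ≤ m) : LcmCyclic K f A m l := by
  refine ⟨0, fun z hz hdz => ⟨0, ins K g z, ?_, ?_⟩⟩
  · refine ins_mem_supported ?_ hz
    refine fun s hs _ => ⟨Finset.insert_subset hg hs.1, ?_⟩
    rw [sup_insert_of_le (hle.trans le_sup_left)]; exact hs.2
  · rw [bd_ins]
    simp only [smul_zero, sub_zero, sub_sub_cancel]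
    refine ins_mem_supported ?_ hdz
    refine fun s hs _ => ⟨Finset.insert_subset hg hs.1, ?_⟩
    rw [sup_insert_of_le (hle.trans le_sup_left)]; exact hs.2

theorem lcmCyclic_of_unique
    (h : ∀ s ⊆ A, ∀ t ⊆ A, m ⊔ s.sup f = l → m ⊔ t.sup f = l → s = t) :
    LcmCyclic K f A m l := by
  by_cases hs : ∃ s ⊆ A, m ⊔ s.sup f = l
  · obtain ⟨s, hsA, hs⟩ := hs
    refine ⟨single s 1, fun z hz _ => ⟨z s, 0, Submodule.zero_mem _, ?_⟩⟩
    rw [map_zero, sub_zero, mem_supported']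
    intro t ht
    rcases eq_or_ne s t with rfl | hst
    · simp
    · by_cases htl : t ∈ lcmDvd f A m l
      · exact absurd (mem_lcmSDvd_of_ne htl fun h' => hst (h s hsA t htl.1 hs h')) ht
      · simp [apply_eq_zero_of_supported hz htl, hst]
  · refine ⟨0, fun z hz _ => ⟨0, 0, Submodule.zero_mem _, ?_⟩⟩
    simp only [smul_zero, map_zero, sub_zero]
    exact supported_mono (fun s h' => mem_lcmSDvd_of_ne h' fun h'' => hs ⟨s, h'.1, h''⟩) hz

/-- Faces without `g` vanish in the strand, and deleting `g` from the others identifies it with the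
strand in which `g` is absorbed into `m`. -/
theorem lcmCyclic_of_forall_mem {g : ι} (hg : g ∈ A) (h : ∀ s ⊆ A, m ⊔ s.sup f = l → g ∈ s)
    (hc : LcmCyclic K f (A.erase g) (m ⊔ f g) l) : LcmCyclic K f A m l := by
  obtain ⟨v, hv⟩ := hc
  refine ⟨ins K g v, fun z hz hdz => ?_⟩
  have hdel : ∀ s : Finset ι, s ⊆ A → g ∈ s → s.erase g ⊆ A.erase g := fun s hs _ =>
    Finset.erase_subset_erase g hs
  have hsup : ∀ s : Finset ι, g ∈ s → (m ⊔ f g) ⊔ (s.erase g).sup f = m ⊔ s.sup f := by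
    intro s hs
    rw [← sup_sup_insert, Finset.insert_erase hs]
  have hu : del K g z ∈ supported K K (lcmDvd f (A.erase g) (m ⊔ f g) l) :=
    del_mem_supported (L := lcmDvd f A m l) (L' := lcmDvd f (A.erase g) (m ⊔ f g) l)
      (fun s hs hgs => ⟨hdel s hs.1 hgs, (hsup s hgs).trans_le hs.2⟩) hz
  have hdu : bd K ι (del K g z) ∈ supported K K (lcmSDvd f (A.erase g) (m ⊔ f g) l) := by
    rw [bd_del]
    exact Submodule.neg_mem _ (del_mem_supported (L := lcmSDvd f A m l)
      (L' := lcmSDvd f (A.erase g) (m ⊔ f g) l)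
      (fun s hs hgs => ⟨hdel s hs.1 hgs, (hsup s hgs).trans_lt hs.2⟩) hdz)
  obtain ⟨c, y, hy, hc⟩ := hv _ hu hdu
  have hins : ∀ s ∈ lcmDvd f (A.erase g) (m ⊔ f g) l, g ∉ s → insert g s ∈ lcmDvd f A m l :=
    fun s hs _ => ⟨Finset.insert_subset hg (hs.1.trans (Finset.erase_subset g A)),
      (sup_sup_insert s g).trans_le hs.2⟩
  have hyA : y ∈ supported K K (lcmSDvd f A m l) := by
    refine supported_mono ?_ hy
    rintro s hs
    have hsA := hs.1.trans (Finset.erase_subset g A)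
    refine mem_lcmSDvd_of_ne ⟨hsA, le_trans ?_ hs.2⟩ fun h' => ?_
    · exact sup_le_sup_right le_sup_left _
    · exact Finset.notMem_erase g A (hs.1 (h s hsA h'))
  -- The sign is there because `ins K g` commutes with the boundary only up to sign. The extra term
  -- `y` from `bd_ins` lies on faces without `g`, hence in smaller multidegrees.
  refine ⟨c, -ins K g y, Submodule.neg_mem _ (ins_mem_supported hins hy), ?_⟩
  have h1 : z - ins K g (del K g z) ∈ supported K K (lcmSDvd f A m l) := by
    refine supported_mono ?_ (sub_ins_del_mem_supported g hz)
    rintro s ⟨hs, hgs⟩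
    exact mem_lcmSDvd_of_ne hs fun h' => hgs (h s hs.1 h')
  have h2 : ins K g (del K g z - c • v - bd K ι y) ∈ supported K K (lcmSDvd f A m l) := by
    refine ins_mem_supported (fun s hs _ => ?_) hc
    exact ⟨Finset.insert_subset hg (hs.1.trans (Finset.erase_subset g A)),
      (sup_sup_insert s g).trans_lt hs.2⟩
  have : z - c • ins K g v - bd K ι (-ins K g y) = (z - ins K g (del K g z)) +
      ins K g (del K g z - c • v - bd K ι y) + y := by
    rw [map_neg, bd_ins]; simp only [map_sub, map_smul]; abel
  rw [this]
  exact Submodule.add_mem _ (Submodule.add_mem _ h1 h2) hyA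

theorem lcmCyclic_of_forall_notMem {g : ι} (h : ∀ s ⊆ A, m ⊔ s.sup f = l → g ∉ s)
    (hc : LcmCyclic K f (A.erase g) m l) : LcmCyclic K f A m l := by
  obtain ⟨v, hv⟩ := hc
  refine ⟨v, fun z hz hdz => ?_⟩
  set z₁ := ins K g (del K g z) with hz₁
  have h1 : z₁ ∈ supported K K (lcmSDvd f A m l) := by
    refine supported_mono ?_ (ins_del_mem_supported g hz)
    rintro s ⟨hs, hgs⟩
    exact mem_lcmSDvd_of_ne hs fun h' => h s hs.1 h' hgs
  have hw : z - z₁ ∈ supported K K (lcmDvd f (A.erase g) m l) := by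
    refine supported_mono ?_ (sub_ins_del_mem_supported g hz)
    rintro s ⟨hs, hgs⟩
    exact ⟨Finset.subset_erase.2 ⟨hs.1, hgs⟩, hs.2⟩
  have hdw : bd K ι (z - z₁) ∈ supported K K (lcmSDvd f (A.erase g) m l) := by
    have h2 : bd K ι (z - z₁) ∈ supported K K (lcmSDvd f A m l) := by
      rw [map_sub]
      exact Submodule.sub_mem _ hdz (bd_mem_lcmSDvd h1)
    have h3 : bd K ι (z - z₁) ∈ supported K K (lcmSDvd f A m l) ⊓ supported K K
      (lcmDvd f (A.erase g) m l) := ⟨h2, bd_mem_lcmDvd hw⟩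
    rw [← supported_inter] at h3
    exact supported_mono (fun s hs => (⟨hs.2.1, hs.1.2⟩ : s ∈ lcmSDvd f _ m l)) h3
  obtain ⟨c, y, hy, hc⟩ := hv _ hw hdw
  refine ⟨c, y, supported_mono (lcmDvd_mono (Finset.erase_subset g A)) hy, ?_⟩
  have : z - c • v - bd K ι y = (z - z₁ - c • v - bd K ι y) + z₁ := by abel
  rw [this]
  exact Submodule.add_mem _ (supported_mono (lcmSDvd_mono (Finset.erase_subset g A)) hc) h1

/-- Each element of `D` belongs to all faces of multidegree `l`, and is absorbed into `m`, or to
none of them, and is dropped. -/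
theorem lcmCyclic_of_inter_eq {D N A₀ : Finset ι} (hDN : Disjoint D N) (hA₀ : A₀ ⊆ D)
    (h : ∀ s ⊆ D ∪ N, m ⊔ s.sup f = l → s ∩ D = A₀)
    (hc : LcmCyclic K f N (m ⊔ A₀.sup f) l) : LcmCyclic K f (D ∪ N) m l := by
  induction D using Finset.induction_on generalizing m A₀ with
  | empty =>
    rw [Finset.subset_empty.1 hA₀] at hc
    simpa using hc
  | insert g D hgD ih =>
    have hgN : g ∉ N := Finset.disjoint_left.1 hDN (Finset.mem_insert_self g D)
    have hDN' : Disjoint D N := hDN.mono_left (Finset.subset_insert g D)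
    have hg : g ∉ D ∪ N := by simp [hgD, hgN]
    have her : (insert g D ∪ N).erase g = D ∪ N := by
      rw [Finset.insert_union, Finset.erase_insert hg]
    by_cases hgA : g ∈ A₀
    · refine lcmCyclic_of_forall_mem (g := g) (by simp) (fun s hs hsl => ?_) ?_
      · rw [← h s hs hsl] at hgA
        exact (Finset.mem_inter.1 hgA).1
      · rw [her]
        refine ih (A₀ := A₀.erase g) hDN' ?_ ?_ ?_
        · rw [← Finset.erase_insert hgD]; exact Finset.erase_subset_erase g hA₀
        · intro s hs hsl
          rw [← sup_sup_insert] at hsl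
          rw [← h (insert g s) ?_ hsl, Finset.insert_inter_of_mem (Finset.mem_insert_self g D)]
          · have hgs : g ∉ s := fun h' => hg (hs h')
            ext x
            by_cases hx : x = g <;> simp [hx, hgs]
          · rw [Finset.insert_union]; exact Finset.insert_subset_insert g hs
        · rwa [← sup_sup_insert, Finset.insert_erase hgA]
    · refine lcmCyclic_of_forall_notMem (g := g) (fun s hs hsl hgs => hgA ?_) ?_
      · rw [← h s hs hsl]; simp [hgs]
      · rw [her]
        refine ih (A₀ := A₀) hDN' ?_ ?_ hc
        · exact (Finset.subset_insert_iff_of_notMem hgA).1 hA₀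
        · intro s hs hsl
          have hs' : s ⊆ insert g D ∪ N := by
            rw [Finset.insert_union]; exact hs.trans (Finset.subset_insert _ _)
          rw [← h s hs' hsl]
          have hgs : g ∉ s := fun h' => hg (hs h')
          ext x
          by_cases hx : x = g <;> simp [hx, hgs]

end Families

/-! ### Minimal generators and iterated decomposition -/

section Generators

variable {K : Type*} [Field K] {n : ℕ} {M : Ideal (MvPolynomial (Fin n) K)}

theorem monomial_mem_ofMonomials {A : Set (Fin n →₀ ℕ)} {a : Fin n →₀ ℕ} :
    MvPolynomial.monomial a (1 : K) ∈ ofMonomials K A ↔ ∃ b ∈ A, b ≤ a := by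
  rw [ofMonomials, MvPolynomial.mem_ideal_span_monomial_image]
  simp

theorem mem_minGens {a : Fin n →₀ ℕ} :
    a ∈ minGens M ↔ Minimal (fun b => MvPolynomial.monomial b (1 : K) ∈ M) a := by
  simp [minGens]

theorem exists_minGens_le {a : Fin n →₀ ℕ} (ha : MvPolynomial.monomial a (1 : K) ∈ M) :
    ∃ b ∈ minGens M, b ≤ a := by
  obtain ⟨b, hb, hmin⟩ := exists_minimal_le_of_wellFoundedLT
    (fun b => MvPolynomial.monomial b (1 : K) ∈ M) a ha
  exact ⟨b, mem_minGens.2 hmin, hb⟩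

theorem monomial_mem_of_le {a b : Fin n →₀ ℕ} (ha : MvPolynomial.monomial a (1 : K) ∈ M)
    (hab : a ≤ b) : MvPolynomial.monomial b (1 : K) ∈ M := by
  rw [← add_tsub_cancel_of_le hab, ← one_mul (1 : K), ← MvPolynomial.monomial_mul]
  exact M.mul_mem_right _ ha

theorem mem_of_mem_minGens_ofMonomials {A : Set (Fin n →₀ ℕ)} {a : Fin n →₀ ℕ}
    (ha : a ∈ minGens (ofMonomials K A)) : a ∈ A := by
  rw [mem_minGens] at ha
  obtain ⟨b, hb, hba⟩ := monomial_mem_ofMonomials.1 ha.1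
  have := ha.2 (monomial_mem_ofMonomials.2 ⟨b, hb, le_rfl⟩) hba
  rwa [le_antisymm this hba]

theorem IsMonomialIdeal.mem_iff (hM : IsMonomialIdeal M) {p : MvPolynomial (Fin n) K} :
    p ∈ M ↔ ∀ a ∈ p.support, MvPolynomial.monomial a (1 : K) ∈ M := by
  obtain ⟨A, rfl⟩ := hM
  simp_rw [monomial_mem_ofMonomials]
  rw [ofMonomials, MvPolynomial.mem_ideal_span_monomial_image]

theorem ofMonomials_minGens (hM : IsMonomialIdeal M) :
    ofMonomials K (minGens M : Set (Fin n →₀ ℕ)) = M := by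
  ext p
  rw [hM.mem_iff, ofMonomials, MvPolynomial.mem_ideal_span_monomial_image]
  refine forall₂_congr fun a _ => ⟨?_, fun h => ?_⟩
  · rintro ⟨b, hb, hba⟩
    exact monomial_mem_of_le (mem_minGens.1 hb).1 hba
  · exact exists_minGens_le h

theorem domGens_union_nondomGens : domGens M ∪ nondomGens M = minGens M := by
  classical
  exact Finset.filter_union_filter_not_eq _ _

theorem isDominant_iff : IsDominant M ↔ nondomGens M = ∅ := by
  simp [IsDominant, nondomGens, Finset.filter_eq_empty_iff]

theorem isPurelyNondominant_iff : IsPurelyNondominant M ↔ nondomGens M = minGens M := by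
  simp [IsPurelyNondominant, nondomGens, Finset.filter_eq_self]

theorem firstIdeal_zero (hM : IsMonomialIdeal M) (h : IsPurelyNondominant M) :
    firstIdeal M 0 = M := by
  unfold firstIdeal
  split_ifs with h0
  · rfl
  · rw [isPurelyNondominant_iff.1 h]
    simpa using ofMonomials_minGens hM

theorem zero_mem_firstIndex : ((0, 0) : ℕ × (Fin n →₀ ℕ)) ∈ firstIndex M := by
  classical
  unfold firstIndex
  split_ifs
  · simp
  · exact Finset.mem_image.2 ⟨∅, by simp, by simp [mdeg]; rfl⟩

/-- One step of the second structural decomposition. -/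
noncomputable def refineAll (D : Multiset (Summand K n)) : Multiset (Summand K n) :=
  D.bind Summand.refine

theorem refineAll_iterate_subset (p : ℕ) {D D' : Multiset (Summand K n)} (h : D ⊆ D') :
    refineAll^[p] D ⊆ refineAll^[p] D' := by
  induction p generalizing D D' with
  | zero => exact h
  | succ p ih =>
    refine ih fun T hT => ?_
    simp only [refineAll, Multiset.mem_bind] at hT ⊢
    obtain ⟨T', hT', hT⟩ := hT
    exact ⟨T', h hT', hT⟩

theorem mem_refineAll_iterate_succ {p : ℕ} {T T' T'' : Summand K n} (h : T' ∈ T.refine)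
    (h' : T'' ∈ refineAll^[p] {T'}) : T'' ∈ refineAll^[p + 1] {T} := by
  rw [Function.iterate_succ_apply]
  refine refineAll_iterate_subset p ?_ h'
  simpa [refineAll] using h

/-- The index `(0, 1)` returns a purely nondominant ideal unchanged, so once it appears it is still
present after any number of further rounds. -/
theorem exists_mem_refineAll_iterate (p : ℕ) (T : Summand K n) (hT : IsMonomialIdeal T.ideal)
    (h : IsPurelyNondominant T.ideal) : ∃ T' ∈ refineAll^[p] {T}, T'.ideal = T.ideal := by
  induction p generalizing T with
  | zero => exact ⟨T, by simp, rfl⟩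
  | succ p ih =>
    obtain ⟨T', hT', hI⟩ := ih ⟨T.shift + 0, T.mon + 0, firstIdeal T.ideal 0⟩
      (by simpa [firstIdeal_zero hT h] using hT) (by simpa [firstIdeal_zero hT h] using h)
    refine ⟨T', mem_refineAll_iterate_succ ?_ hT', hI.trans (firstIdeal_zero hT h)⟩
    exact Multiset.mem_map.2 ⟨(0, 0), zero_mem_firstIndex, rfl⟩

end Generators

/-! ### Dominance and the induction along the decomposition -/

section Dominance

variable {K : Type*} [Field K] {ι : Type*} {n : ℕ}
  {f : ι → Fin n →₀ ℕ} {m : Fin n →₀ ℕ}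

/-- Several indices may give the same quotient, and some quotients are redundant. The set `B`
selects one index for each minimal generator. -/
theorem exists_subset_minGens (A : Finset ι) :
    ∃ B ⊆ A, Set.InjOn (fun a => f a - m) B ∧
      B.image (fun a => f a - m) = minGens (ofMonomials K ((fun a => f a - m) '' (A : Set ι))) ∧
      ∀ h ∈ A, ∃ g ∈ B, f g ≤ m ⊔ f h := by
  set I := ofMonomials K ((fun a => f a - m) '' (A : Set ι)) with hI
  have hsurj : Set.SurjOn (fun a => f a - m) A (minGens I) :=
    fun γ hγ => mem_of_mem_minGens_ofMonomials hγ
  obtain ⟨B, hBA, hB⟩ := hsurj.exists_bijOn_subset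
  lift B to Finset ι using A.finite_toSet.subset hBA
  have him : B.image (fun a => f a - m) = minGens I := by
    apply Finset.coe_injective
    rw [Finset.coe_image]
    exact hB.image_eq
  refine ⟨B, by exact_mod_cast hBA, hB.injOn, him, fun h hh => ?_⟩
  obtain ⟨b, hb, hbh⟩ := exists_minGens_le (M := I)
    (monomial_mem_ofMonomials.2 ⟨f h - m, ⟨h, hh, rfl⟩, le_rfl⟩)
  rw [← him, Finset.mem_image] at hb
  obtain ⟨g, hg, rfl⟩ := hb
  refine ⟨g, hg, fun x => ?_⟩
  have := hbh x
  simp only [tsub_apply, sup_apply] at this ⊢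
  omega

variable [LinearOrder ι]

theorem sup_apply_lt {t : Finset ι} {x : Fin n} {c : ℕ} (hm : m x < c)
    (ht : ∀ h ∈ t, f h x < c) : (m ⊔ t.sup f) x < c := by
  induction t using Finset.induction_on generalizing m with
  | empty => simpa using hm
  | insert g t hg ih =>
    rw [sup_sup_insert]
    refine ih ?_ fun h hh => ht h (Finset.mem_insert_of_mem hh)
    simpa using ⟨hm, ht g (Finset.mem_insert_self g t)⟩

theorem add_sup_tsub (t : Finset ι) : m + t.sup (fun a => f a - m) = m ⊔ t.sup f := by
  induction t using Finset.induction_on with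
  | empty => ext x; simp; rfl
  | insert g t _ ih =>
    rw [Finset.sup_insert, Finset.sup_insert]
    have h1 := DFunLike.congr_fun ih
    ext x
    have := h1 x
    simp only [Finsupp.add_apply, sup_apply, tsub_apply] at this ⊢
    omega

/-- If `f g / m` is dominant in the set of all `f a / m`, with `a` in `B`, then the multidegree of
a subset of `B` tells whether `g` belongs to it. -/
theorem mem_of_sup_eq {B : Finset ι} {G : Finset (Fin n →₀ ℕ)} {g : ι}
    (hB : ∀ a ∈ B, f a - m ∈ G) (hinj : Set.InjOn (fun a => f a - m) B)
    (hpos : ∀ a ∈ B, ¬ f a ≤ m) (hg : g ∈ B) (hdom : IsDominantIn G (f g - m))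
    {s t : Finset ι} (ht : t ⊆ B)
    (hst : m ⊔ s.sup f = m ⊔ t.sup f) (hgs : g ∈ s) : g ∈ t := by
  obtain ⟨x, hx⟩ : ∃ x, m x < f g x ∧ ∀ h ∈ B, h ≠ g → f h x < f g x := by
    have key : ∀ x h, h ∈ B → h ≠ g → (∀ m' ∈ G, m' ≠ f g - m → m' x < (f g - m) x) →
        m x < f g x ∧ f h x < f g x := by
      intro x h hh hhg hx
      have := hx _ (hB h hh) fun h' => hhg (hinj hh hg h')
      simp only [tsub_apply] at this
      omega
    -- A second element of `B` forces the exponent of the quotient at the dominating variable to be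
    -- positive. If `g` is alone, dominance need not give this, and a suitable variable comes from
    -- `f g` not dividing `m`.
    by_cases hex : ∃ h ∈ B, h ≠ g
    · obtain ⟨x, hx⟩ := hdom
      obtain ⟨h, hh, hhg⟩ := hex
      exact ⟨x, (key x h hh hhg hx).1, fun h hh hhg => (key x h hh hhg hx).2⟩
    · push Not at hex
      have := hpos g hg
      rw [Finsupp.le_def] at this
      push Not at this
      obtain ⟨x, hx⟩ := this
      exact ⟨x, hx, fun h hh hhg => absurd (hex h hh) hhg⟩
  by_contra hgt
  have h1 := sup_apply_lt (f := f) (t := t) hx.1 fun h hh =>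
    hx.2 h (ht hh) fun h' => hgt (h' ▸ hh)
  have h2 : f g ≤ m ⊔ s.sup f := (Finset.le_sup hgs).trans le_sup_right
  rw [hst] at h2
  exact absurd (h2 x) h1.not_ge

variable [Fintype ι]

/-- After removal of redundant generators, a face can be read off from its multidegree, so the
strand has at most one basis element. The unit ideal is separate: there the strand is contractible.
-/
theorem lcmCyclic_of_isDominant {A : Finset ι} {l : Fin n →₀ ℕ}
    (h : IsDominant (ofMonomials K ((fun a => f a - m) '' (A : Set ι)))) :
    LcmCyclic K f A m l := by
  obtain ⟨B, hBA, hinj, him, hdom⟩ := exists_subset_minGens (K := K) (f := f) (m := m) A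
  refine lcmCyclic_of_subset hBA hdom ?_
  by_cases hpos : ∀ a ∈ B, ¬ f a ≤ m
  · have hB : ∀ a ∈ B, f a - m ∈ minGens (ofMonomials K ((fun a => f a - m) '' (A : Set ι))) :=
      fun a ha => him ▸ Finset.mem_image_of_mem _ ha
    refine lcmCyclic_of_unique fun s hs t ht hsl htl => ?_
    ext g
    exact ⟨fun hg => mem_of_sup_eq hB hinj hpos (hs hg) (h _ (hB _ (hs hg))) ht
        (hsl.trans htl.symm) hg,
      fun hg => mem_of_sup_eq hB hinj hpos (ht hg) (h _ (hB _ (ht hg))) hs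
        (htl.trans hsl.symm) hg⟩
  · push Not at hpos
    obtain ⟨a, ha, hle⟩ := hpos
    exact lcmCyclic_of_le ha hle

/-- The disjunction `hcard` is what one round preserves. The new ideal has at most as many minimal
generators as the old one has nondominant ones; so the number of nondominant generators drops, or
all generators are nondominant. In the latter case persistence and `h` force the ideal to be
dominant. -/
theorem lcmCyclic_of_refineAll (p : ℕ) (A : Finset ι) (m : Fin n →₀ ℕ) (T : Summand K n)
    (hT : T.ideal = ofMonomials K ((fun a => f a - m) '' (A : Set ι)))
    (hcard : (nondomGens T.ideal).card ≤ p ∨ IsPurelyNondominant T.ideal)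
    (h : ∀ T' ∈ refineAll^[p] {T}, ¬ (IsPurelyNondominant T'.ideal ∧ ¬ IsDominant T'.ideal))
    (l : Fin n →₀ ℕ) : LcmCyclic K f A m l := by
  classical
  induction p generalizing A m T l with
  | zero =>
    refine lcmCyclic_of_isDominant (K := K) ?_
    rw [← hT]
    rcases hcard with h0 | h0
    · rw [isDominant_iff, ← Finset.card_eq_zero]; omega
    · by_contra h1
      exact h T (by simp) ⟨h0, h1⟩
  | succ p ih =>
    by_cases hD : IsDominant T.ideal
    · exact lcmCyclic_of_isDominant (hT ▸ hD)
    by_cases hP : IsPurelyNondominant T.ideal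
    · obtain ⟨T', hT', hI⟩ := exists_mem_refineAll_iterate (p + 1) T ⟨_, hT⟩ hP
      exact absurd ⟨by rwa [hI], by rwa [hI]⟩ (h T' hT')
    replace hcard := hcard.resolve_right hP
    have hne : nondomGens T.ideal ≠ ∅ := fun h' => hD (isDominant_iff.2 h')
    obtain ⟨B, hBA, hinj, him, hdom⟩ := exists_subset_minGens (K := K) (f := f) (m := m) A
    rw [← hT] at him
    refine lcmCyclic_of_subset hBA hdom ?_
    by_cases hpos : ∀ a ∈ B, ¬ f a ≤ m
    swap
    · push Not at hpos
      obtain ⟨a, ha, hle⟩ := hpos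
      exact lcmCyclic_of_le ha hle
    have hB : ∀ a ∈ B, f a - m ∈ minGens T.ideal := fun a ha =>
      him ▸ Finset.mem_image_of_mem _ ha
    set D := B.filter fun a => f a - m ∈ domGens T.ideal with hDdef
    set N := B.filter fun a => ¬ f a - m ∈ domGens T.ideal with hNdef
    have hDN : D ∪ N = B := Finset.filter_union_filter_not_eq _ _
    have hdisj : Disjoint D N := Finset.disjoint_filter_filter_not _ _ _
    have hNim : (fun a => f a - m) '' (N : Set ι) = nondomGens T.ideal := by
      ext γ
      simp only [hNdef, Finset.coe_filter, Set.mem_image, Set.mem_ofPred_eq, SetLike.mem_coe]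
      constructor
      · rintro ⟨a, ⟨ha, hna⟩, rfl⟩
        have := hB a ha
        rw [← domGens_union_nondomGens, Finset.mem_union] at this
        exact this.resolve_left hna
      · intro hγ
        have hγ' := hγ
        simp only [nondomGens, Finset.mem_filter] at hγ'
        have := hγ'.1
        rw [← him, Finset.mem_image] at this
        obtain ⟨a, ha, rfl⟩ := this
        exact ⟨a, ⟨ha, fun h' => hγ'.2 (Finset.mem_filter.1 h').2⟩, rfl⟩
    rw [← hDN]
    -- One face of multidegree `l` fixes the dominant part of all of them; if there is none, the
    -- strand is zero.
    by_cases hs : ∃ s ⊆ D ∪ N, m ⊔ s.sup f = l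
    swap
    · exact lcmCyclic_of_unique fun s hsB _ _ hsl => absurd ⟨s, hsB, hsl⟩ hs
    obtain ⟨s, hsB, hsl⟩ := hs
    have hmem : ∀ s ⊆ D ∪ N, ∀ t ⊆ D ∪ N, m ⊔ s.sup f = l → m ⊔ t.sup f = l →
        s ∩ D ⊆ t ∩ D := by
      intro s hs t ht hsl htl g hg
      rw [Finset.mem_inter] at hg ⊢
      refine ⟨mem_of_sup_eq hB hinj hpos (Finset.mem_filter.1 hg.2).1 ?_ (hDN ▸ ht)
        (hsl.trans htl.symm) hg.1, hg.2⟩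
      exact (Finset.mem_filter.1 (Finset.mem_filter.1 hg.2).2).2
    refine lcmCyclic_of_inter_eq (A₀ := s ∩ D) hdisj Finset.inter_subset_right
      (fun t ht htl => (hmem t ht s hsB htl hsl).antisymm (hmem s hsB t ht hsl htl)) ?_
    set S := (s ∩ D).image fun a => f a - m with hS
    have hmS : m + mdeg S = m ⊔ (s ∩ D).sup f := by
      rw [← add_sup_tsub, mdeg, hS, Finset.sup_image]; rfl
    -- Dividing out `m` and then `mdeg S` amounts to dividing out their product, which is the lcm of
    -- `m` with the dominant part of `s`.
    have hT' : firstIdeal T.ideal (mdeg S) =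
        ofMonomials K ((fun a => f a - (m ⊔ (s ∩ D).sup f)) '' (N : Set ι)) := by
      rw [firstIdeal, if_neg hne, ← hNim, Set.image_image, ← hmS]
      congr 2
      ext a x
      simp only [tsub_apply, sup_apply, Finsupp.add_apply]
      omega
    refine ih N _ ⟨T.shift + S.card, T.mon + mdeg S, firstIdeal T.ideal (mdeg S)⟩ hT' ?_ ?_ l
    · have hle : (minGens (firstIdeal T.ideal (mdeg S))).card ≤ (nondomGens T.ideal).card := by
        refine le_trans (Finset.card_le_card (t := (nondomGens T.ideal).image
          fun h => (mdeg S ⊔ h) - mdeg S) ?_) Finset.card_image_le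
        intro γ hγ
        rw [firstIdeal, if_neg hne] at hγ
        have := mem_of_mem_minGens_ofMonomials hγ
        rwa [← Finset.coe_image, SetLike.mem_coe] at this
      have hsub : nondomGens (firstIdeal T.ideal (mdeg S)) ⊆
          minGens (firstIdeal T.ideal (mdeg S)) := Finset.filter_subset _ _
      rcases (Finset.card_le_card hsub).lt_or_eq with hlt | heq
      · left; dsimp only; omega
      · right
        exact isPurelyNondominant_iff.2 (Finset.eq_of_subset_of_card_le hsub heq.ge)
    · intro T'' hT''
      refine h T'' (mem_refineAll_iterate_succ ?_ hT'')
      refine Multiset.mem_map.2 ⟨(S.card, mdeg S), ?_, rfl⟩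
      rw [Finset.mem_val, firstIndex, if_neg hne]
      refine Finset.mem_image.2 ⟨S, Finset.mem_powerset.2 ?_, rfl⟩
      intro γ hγ
      obtain ⟨a, ha, rfl⟩ := Finset.mem_image.1 hγ
      exact (Finset.mem_filter.1 (Finset.mem_inter.1 ha).2).2

theorem lcmCyclic_of_purelyNondominantPart_eq_zero (M : Ideal (MvPolynomial (Fin n) K))
    (hpart : purelyNondominantPart M = 0)
    (hM : M = ofMonomials K (Set.range f)) (l : Fin n →₀ ℕ) :
    LcmCyclic K f Finset.univ 0 l := by
  refine lcmCyclic_of_refineAll (nondomGens M).card Finset.univ 0 ⟨0, 0, M⟩ ?_ (Or.inl le_rfl) ?_ l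
  · simpa using hM
  · intro T hT
    classical
    rw [purelyNondominantPart] at hpart
    exact Multiset.filter_eq_nil.1 hpart T hT

end Dominance

/-! ### Scalar resolutions and their retracts -/

/-- The scalar form of a multigraded free resolution of `S/M`, where `U` is the set of the
monomials of `M`: a complex of vector spaces with a basis `B` of elements with a homological degree
and a multidegree, which is exact in each multidegree. -/
structure ScalarResolution (K : Type*) [Field K] {n : ℕ} (U : Set (Fin n →₀ ℕ)) where
  B : Type
  hdeg : B → ℕ
  mdeg : B → Fin n →₀ ℕ
  d : (B →₀ K) →ₗ[K] (B →₀ K)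
  ε : (B →₀ K) →ₗ[K] K
  d_mem : ∀ b, d (single b 1) ∈ supported K K {c | hdeg c + 1 = hdeg b ∧ mdeg c ≤ mdeg b}
  ε_pos : ∀ b, hdeg b ≠ 0 → ε (single b 1) = 0
  d_d : ∀ v, d (d v) = 0
  -- `S/M` vanishes in the multidegrees of `U`, so the augmentation is constrained only outside
  -- them.
  ε_d : ∀ b, mdeg b ∉ U → ε (d (single b 1)) = 0
  exact : ∀ i a, ∀ v ∈ supported K K {b | hdeg b = i ∧ mdeg b ≤ a}, d v = 0 →
    (a ∉ U → ε v = 0) → ∃ w ∈ supported K K {b | hdeg b = i + 1 ∧ mdeg b ≤ a}, d w = v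
  surj : ∀ a ∉ U, ∃ v ∈ supported K K {b | hdeg b = 0 ∧ mdeg b ≤ a}, ε v = 1

theorem graded_map_mem {K X Y : Type*} [Field K] {n : ℕ} {hX : X → ℕ} {hY : Y → ℕ}
    {dX : X → Fin n →₀ ℕ} {dY : Y → Fin n →₀ ℕ} {f : (X →₀ K) →ₗ[K] (Y →₀ K)}
    (hf : ∀ x, f (single x 1) ∈ supported K K {y | hY y = hX x ∧ dY y ≤ dX x})
    {D : Set (Fin n →₀ ℕ)} (hD : IsLowerSet D) {i : ℕ} {v : X →₀ K}
    (hv : v ∈ supported K K {x | hX x = i ∧ dX x ∈ D}) :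
    f v ∈ supported K K {y | hY y = i ∧ dY y ∈ D} :=
  map_mem_of_supported (fun x hx => supported_mono
    (fun y hy => (⟨hy.1.trans hx.1, hD hy.2 hx.2⟩ : hY y = i ∧ dY y ∈ D)) (hf x)) hv

namespace ScalarResolution

variable {K : Type*} [Field K] {n : ℕ} {U : Set (Fin n →₀ ℕ)} (C : ScalarResolution K U)

/-- The matrices of the differential have no invertible entries. -/
def IsMinimal : Prop :=
  ∀ b c, C.mdeg c = C.mdeg b → C.d (single b 1) c = 0

/-- In multidegree `l`, the homology of the complex modulo smaller multidegrees is generated by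
one element. -/
def CyclicAt (l : Fin n →₀ ℕ) : Prop :=
  HomologyCyclic C.d {b | C.mdeg b ≤ l} {b | C.mdeg b < l}

/-- The basis elements of multidegree `l`. -/
def fiber (l : Fin n →₀ ℕ) : Set C.B := {b | C.mdeg b = l}

variable {C}

theorem ε_eq_zero {i : ℕ} (hi : i ≠ 0) {D : Set (Fin n →₀ ℕ)} {v : C.B →₀ K}
    (hv : v ∈ supported K K {b | C.hdeg b = i ∧ C.mdeg b ∈ D}) : C.ε v = 0 :=
  map_mem_of_supported (N := (⊥ : Submodule K K)) 
    (fun b (hb : C.hdeg b = i ∧ _) => C.ε_pos b (hb.1 ▸ hi)) hv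

theorem ε_d_eq_zero (hU : IsUpperSet U) {a : Fin n →₀ ℕ} (ha : a ∉ U) {v : C.B →₀ K}
    (hv : v ∈ supported K K {b | C.mdeg b ≤ a}) : C.ε (C.d v) = 0 :=
  map_mem_of_supported (f := C.ε ∘ₗ C.d) (N := (⊥ : Submodule K K))
    (fun b hb => C.ε_d b fun h => ha (hU hb h)) hv

/-- A multigraded retract of a resolution, onto which the differential descends. -/
noncomputable def retract (hU : IsUpperSet U) (C : ScalarResolution K U) {B' : Type}
    (hdeg' : B' → ℕ) (mdeg' : B' → Fin n →₀ ℕ)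
    (j : (B' →₀ K) →ₗ[K] (C.B →₀ K)) (p : (C.B →₀ K) →ₗ[K] (B' →₀ K))
    (hj : ∀ x, j (single x 1) ∈
      supported K K {y | C.hdeg y = hdeg' x ∧ C.mdeg y ≤ mdeg' x})
    (hp : ∀ x, p (single x 1) ∈
      supported K K {y | hdeg' y = C.hdeg x ∧ mdeg' y ≤ C.mdeg x})
    -- By `hdj` the image of `j` is a subcomplex, and by `hpd` the kernel of `p` is one. So both
    -- maps are chain maps for the new differential `p ∘ d ∘ j`.
    (hpj : ∀ v, p (j v) = v) (hdj : ∀ v, j (p (C.d (j v))) = C.d (j v))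
    (hpd : ∀ v, p (C.d (j (p v))) = p (C.d v))
    (hε : ∀ x, C.mdeg x ∉ U → C.ε (j (p (single x 1))) = C.ε (single x 1)) :
    ScalarResolution K U where
  B := B'
  hdeg := hdeg'
  mdeg := mdeg'
  d := p ∘ₗ C.d ∘ₗ j
  ε := C.ε ∘ₗ j
  d_mem x := by
    refine map_mem_of_supported (f := p ∘ₗ C.d) (fun y hy => ?_) (hj x)
    refine map_mem_of_supported (f := p) (fun z hz => ?_) (C.d_mem y)
    refine supported_mono ?_ (hp z)
    rintro t ⟨ht, ht'⟩
    exact ⟨by rw [ht, hz.1, hy.1], ht'.trans (hz.2.trans hy.2)⟩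
  ε_pos x hx := ε_eq_zero (D := Set.Iic (mdeg' x)) hx (hj x)
  d_d v := by
    simp only [LinearMap.comp_apply]
    rw [hpd, C.d_d, map_zero]
  ε_d x hx := by
    simp only [LinearMap.comp_apply]
    rw [hdj]
    exact ε_d_eq_zero hU hx (supported_mono (fun y hy => hy.2) (hj x))
  exact i a v hv hdv hεv := by
    simp only [LinearMap.comp_apply] at hdv hεv
    obtain ⟨w, hw, hdw⟩ := C.exact i a (j v)
      (graded_map_mem hj (isLowerSet_Iic a) hv)
      (by rw [← hdj, hdv, map_zero]) hεv
    refine ⟨p w, graded_map_mem hp (isLowerSet_Iic a) hw, ?_⟩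
    simp only [LinearMap.comp_apply]
    rw [hpd, hdw, hpj]
  surj a ha := by
    obtain ⟨v, hv, hεv⟩ := C.surj a ha
    refine ⟨p v, graded_map_mem hp (isLowerSet_Iic a) hv, ?_⟩
    rw [← hεv]
    exact eqOn_supported (f := C.ε ∘ₗ j ∘ₗ p) (g := C.ε)
      (fun b hb => hε b fun h => ha (hU hb.2 h)) hv

/-! ### Cancelling a pair of basis elements -/

section Cancel

variable {b c : C.B}

/-- The inclusion of the resolution with `b` and `c` cancelled. -/
noncomputable def cancelIncl (C : ScalarResolution K U) (b c : C.B) :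
    (({b, c}ᶜ : Set C.B) →₀ K) →ₗ[K] (C.B →₀ K) :=
  lmapDomain K K Subtype.val -
    (LinearMap.toSpanSingleton K _ ((C.d (single b 1) c)⁻¹ • single b (1 : K)) ∘ₗ lapply c ∘ₗ
      C.d ∘ₗ lmapDomain K K Subtype.val)

/-- The projection to the resolution with `b` and `c` cancelled. -/
noncomputable def cancelProj (C : ScalarResolution K U) (b c : C.B) :
    (C.B →₀ K) →ₗ[K] (({b, c}ᶜ : Set C.B) →₀ K) :=
  lsubtypeDomain ({b, c}ᶜ : Set C.B) ∘ₗ (LinearMap.id -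
    (LinearMap.toSpanSingleton K _ ((C.d (single b 1) c)⁻¹ • C.d (single b 1)) ∘ₗ lapply c))

theorem cancelIncl_apply (v : ({b, c}ᶜ : Set C.B) →₀ K) :
    cancelIncl C b c v = v.mapDomain Subtype.val -
      (C.d (v.mapDomain Subtype.val) c * (C.d (single b 1) c)⁻¹) • single b 1 := by
  simp [cancelIncl, LinearMap.toSpanSingleton_apply, mul_smul]

theorem cancelProj_apply (v : C.B →₀ K) :
    cancelProj C b c v = (v - (v c * (C.d (single b 1) c)⁻¹) • C.d (single b 1)).subtypeDomain
      (· ∈ ({b, c}ᶜ : Set C.B)) := by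
  simp only [cancelProj, LinearMap.comp_apply, LinearMap.sub_apply, LinearMap.id_apply,
    LinearMap.toSpanSingleton_apply, lapply_apply, mul_smul]
  rfl

theorem deg_of_d_apply_ne_zero {x y : C.B} (h : C.d (single x 1) y ≠ 0) :
    C.hdeg y + 1 = C.hdeg x ∧ C.mdeg y ≤ C.mdeg x := by
  by_contra h'
  exact h (apply_eq_zero_of_supported (C.d_mem x) h')

/-- The part split off by the cancellation is spanned by `b` and its boundary: including after
projecting changes a chain only by such elements. -/
theorem exists_sub_cancel_eq (hu : C.d (single b 1) c ≠ 0) (v : C.B →₀ K) :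
    ∃ α : K, v - cancelIncl C b c (cancelProj C b c v) =
      α • single b 1 + (v c * (C.d (single b 1) c)⁻¹) • C.d (single b 1) := by
  classical
  set u := C.d (single b 1) c with hu'
  set w := v - (v c * u⁻¹) • C.d (single b 1) with hw
  have hwc : w c = 0 := by simp [hw, ← hu', hu]
  have h1 : (w.subtypeDomain (· ∈ ({b, c}ᶜ : Set C.B))).mapDomain Subtype.val =
      w - w b • single b 1 := by
    ext x
    by_cases hx : x ∈ ({b, c}ᶜ : Set C.B)
    · have := mapDomain_apply Subtype.val_injective (w.subtypeDomain (· ∈ ({b, c}ᶜ : Set C.B)))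
        ⟨x, hx⟩
      rw [this]
      have hxb : b ≠ x := fun h => hx (by simp [h])
      simp [hxb]
    · rw [mapDomain_of_notMem_range _ _ (by simpa using hx)]
      have hx' : x = b ∨ x = c := by simpa [or_iff_not_imp_left] using hx
      have hbc : b ≠ c := by
        rintro rfl
        have := (deg_of_d_apply_ne_zero hu).1
        omega
      rcases hx' with rfl | rfl
      · simp
      · simp [hwc, hbc]
  rw [cancelProj_apply, cancelIncl_apply, ← hu', ← hw, h1]
  refine ⟨w b + C.d (w - w b • single b 1) c * u⁻¹, ?_⟩
  rw [hw]
  module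

theorem cancelProj_d_single (hu : C.d (single b 1) c ≠ 0) :
    cancelProj C b c (C.d (single b 1)) = 0 := by
  rw [cancelProj_apply, mul_inv_cancel₀ hu, one_smul, sub_self, subtypeDomain_zero]

theorem cancelIncl_apply_self (hu : C.d (single b 1) c ≠ 0) (v : ({b, c}ᶜ : Set C.B) →₀ K) :
    cancelIncl C b c v c = 0 := by
  classical
  have hbc : b ≠ c := by
    rintro rfl
    have := (deg_of_d_apply_ne_zero hu).1
    omega
  rw [cancelIncl_apply, Finsupp.sub_apply, mapDomain_of_notMem_range _ _ (by simp)]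
  simp [hbc]

theorem d_cancelIncl_apply_self (hu : C.d (single b 1) c ≠ 0)
    (v : ({b, c}ᶜ : Set C.B) →₀ K) : C.d (cancelIncl C b c v) c = 0 := by
  rw [cancelIncl_apply, map_sub, map_smul, Finsupp.sub_apply, Finsupp.smul_apply, smul_eq_mul,
    mul_assoc, inv_mul_cancel₀ hu, mul_one, sub_self]

/-- The defect is a multiple of `b`, and the coefficient of its boundary at `c` is zero, so it
vanishes. -/
theorem cancelIncl_cancelProj (hu : C.d (single b 1) c ≠ 0) {v : C.B →₀ K} (hv : v c = 0)
    (hdv : C.d v c = 0) : cancelIncl C b c (cancelProj C b c v) = v := by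
  obtain ⟨α, hα⟩ := exists_sub_cancel_eq hu v
  rw [hv, zero_mul, zero_smul, add_zero] at hα
  have h1 := congrArg (fun w => C.d w c) hα
  simp only [map_sub, map_smul, Finsupp.sub_apply, Finsupp.smul_apply, hdv,
    d_cancelIncl_apply_self hu, sub_zero, smul_eq_mul] at h1
  have : α = 0 := by
    rcases mul_eq_zero.1 h1.symm with h | h
    · exact h
    · exact absurd h hu
  rw [this, zero_smul] at hα
  exact (sub_eq_zero.1 hα).symm

/-- Two basis elements joined by an invertible entry of the differential are cancelled. -/
noncomputable def cancel (hU : IsUpperSet U) (C : ScalarResolution K U) (b c : C.B)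
    (hu : C.d (single b 1) c ≠ 0) (hbc : C.mdeg c = C.mdeg b) : ScalarResolution K U :=
  C.retract hU (B' := ({b, c}ᶜ : Set C.B)) (fun x => C.hdeg x) (fun x => C.mdeg x)
    (cancelIncl C b c) (cancelProj C b c)
    (by
      intro x
      rw [cancelIncl_apply, mapDomain_single]
      refine Submodule.sub_mem _ (single_mem_supported K _ ⟨rfl, le_rfl⟩) ?_
      by_cases hx : C.d (single (x : C.B) 1) c = 0
      · simp [hx]
      · have h1 := deg_of_d_apply_ne_zero hx
        have h2 := deg_of_d_apply_ne_zero hu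
        exact Submodule.smul_mem _ _ (single_mem_supported K _
          ⟨h2.1.symm.trans h1.1, hbc.ge.trans h1.2⟩))
    (by
      classical
      intro x
      rw [mem_supported']
      rintro ⟨y, hy⟩ hy'
      have hxy : x ≠ y := by
        rintro rfl
        exact hy' ⟨rfl, le_rfl⟩
      rw [cancelProj_apply]
      simp only [subtypeDomain_apply, Finsupp.sub_apply, single_eq_of_ne hxy.symm,
        Finsupp.smul_apply]
      by_cases hx : x = c
      · subst hx
        have : C.d (single b 1) y = 0 := by
          by_contra h
          have h1 := deg_of_d_apply_ne_zero h
          have h2 := deg_of_d_apply_ne_zero hu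
          exact hy' ⟨by dsimp only; omega, h1.2.trans hbc.ge⟩
        simp [this]
      · simp [single_eq_of_ne (Ne.symm hx)])
    (by
      intro v
      rw [cancelProj_apply, cancelIncl_apply_self hu, zero_mul, zero_smul, sub_zero,
        cancelIncl_apply]
      ext ⟨x, hx⟩
      have hxb : x ≠ b := fun h => hx (by simp [h])
      have := mapDomain_apply Subtype.val_injective v ⟨x, hx⟩
      simp only [subtypeDomain_apply, Finsupp.sub_apply, Finsupp.smul_apply,
        single_eq_of_ne hxb, smul_zero, sub_zero]
      exact this)
    (fun v => cancelIncl_cancelProj hu (d_cancelIncl_apply_self hu v) (by rw [C.d_d]; rfl))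
    (by
      intro v
      obtain ⟨α, hα⟩ := exists_sub_cancel_eq hu v
      rw [eq_comm, ← sub_eq_zero, ← map_sub, ← map_sub, hα, map_add, map_smul, map_smul, C.d_d,
        smul_zero, add_zero, map_smul, cancelProj_d_single hu, smul_zero])
    (by
      intro x hx
      obtain ⟨α, hα⟩ := exists_sub_cancel_eq hu (single x 1)
      have hb : C.hdeg b ≠ 0 := by
        have := (deg_of_d_apply_ne_zero hu).1
        omega
      rw [eq_comm, ← sub_eq_zero, ← map_sub, hα, map_add, map_smul, map_smul, C.ε_pos b hb,
        smul_zero, zero_add]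
      rcases eq_or_ne c x with rfl | hxc
      · rw [C.ε_d b (hbc ▸ hx), smul_zero]
      · simp [single_eq_of_ne hxc])

end Cancel

/-- Both `j` and `p` are chain maps that do not raise multidegrees, so `p` carries a generator of
the homology to a generator. -/
theorem retract_cyclicAt (hU : IsUpperSet U) {B' : Type}
    {hdeg' : B' → ℕ} {mdeg' : B' → Fin n →₀ ℕ}
    {j : (B' →₀ K) →ₗ[K] (C.B →₀ K)} {p : (C.B →₀ K) →ₗ[K] (B' →₀ K)}
    (hj : ∀ x, j (single x 1) ∈
      supported K K {y | C.hdeg y = hdeg' x ∧ C.mdeg y ≤ mdeg' x})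
    (hp : ∀ x, p (single x 1) ∈
      supported K K {y | hdeg' y = C.hdeg x ∧ mdeg' y ≤ C.mdeg x})
    (hpj : ∀ v, p (j v) = v) (hdj : ∀ v, j (p (C.d (j v))) = C.d (j v))
    (hpd : ∀ v, p (C.d (j (p v))) = p (C.d v))
    (hε : ∀ x, C.mdeg x ∉ U → C.ε (j (p (single x 1))) = C.ε (single x 1))
    {l : Fin n →₀ ℕ} (h : C.CyclicAt l) :
    (C.retract hU hdeg' mdeg' j p hj hp hpj hdj hpd hε).CyclicAt l := by
  obtain ⟨v, hv⟩ := h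
  change HomologyCyclic (p ∘ₗ C.d ∘ₗ j) {x | mdeg' x ≤ l} {x | mdeg' x < l}
  refine ⟨p v, fun z hz hdz => ?_⟩
  have hjle : ∀ w ∈ supported K K {x | mdeg' x ≤ l}, j w ∈ supported K K {x | C.mdeg x ≤ l} :=
    fun w hw => map_mem_of_supported (fun x hx => supported_mono
      (fun y hy => hy.2.trans hx) (hj x)) hw
  have hjlt : ∀ w ∈ supported K K {x | mdeg' x < l}, j w ∈ supported K K {x | C.mdeg x < l} :=
    fun w hw => map_mem_of_supported (fun x hx => supported_mono
      (fun y hy => hy.2.trans_lt hx) (hj x)) hw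
  have hple : ∀ w ∈ supported K K {x | C.mdeg x ≤ l}, p w ∈ supported K K {x | mdeg' x ≤ l} :=
    fun w hw => map_mem_of_supported (fun x hx => supported_mono
      (fun y hy => hy.2.trans hx) (hp x)) hw
  have hplt : ∀ w ∈ supported K K {x | C.mdeg x < l}, p w ∈ supported K K {x | mdeg' x < l} :=
    fun w hw => map_mem_of_supported (fun x hx => supported_mono
      (fun y hy => hy.2.trans_lt hx) (hp x)) hw
  have hdz' : C.d (j z) ∈ supported K K {x | C.mdeg x < l} := by
    rw [← hdj]
    exact hjlt _ hdz
  obtain ⟨c, y, hy, hc⟩ := hv (j z) (hjle z hz) hdz'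
  refine ⟨c, p y, hple y hy, ?_⟩
  have := hplt _ hc
  rw [map_sub, map_sub, hpj, map_smul, ← hpd] at this
  exact this

/-- The elements `b` and `c` are distinct of equal multidegree, so a fiber loses both or neither. -/
theorem ncard_fiber_cancel (hU : IsUpperSet U) [Finite C.B] {b c : C.B}
    (hu : C.d (single b 1) c ≠ 0) (hbc : C.mdeg c = C.mdeg b) (l : Fin n →₀ ℕ) :
    Odd ((C.cancel hU b c hu hbc).fiber l).ncard ↔ Odd (C.fiber l).ncard := by
  have h1 : ((C.cancel hU b c hu hbc).fiber l).ncard = (C.fiber l \ {b, c}).ncard := by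
    have : (C.fiber l \ {b, c} : Set C.B) =
        (Subtype.val : ({b, c}ᶜ : Set C.B) → C.B) '' ((C.cancel hU b c hu hbc).fiber l) := by
      ext x
      constructor
      · rintro ⟨hx, hx'⟩
        exact ⟨⟨x, hx'⟩, hx, rfl⟩
      · rintro ⟨x, hx, rfl⟩
        exact ⟨hx, x.2⟩
    rw [this]
    exact (Set.ncard_image_of_injective _ Subtype.val_injective).symm
  rw [h1]
  have hne : b ≠ c := by
    rintro rfl
    have := (deg_of_d_apply_ne_zero hu).1
    omega
  by_cases hl : C.mdeg b = l
  · have hsub : ({b, c} : Set C.B) ⊆ C.fiber l := by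
      rintro x (rfl | rfl)
      · exact hl
      · exact hbc.trans hl
    rw [← Set.ncard_sdiff_add_ncard_of_subset hsub, Set.ncard_pair hne]
    simp [Nat.odd_add]
  · rw [sdiff_eq_left.2]
    rw [Set.disjoint_left]
    rintro x hx (rfl | rfl)
    · exact hl hx
    · exact hl (hbc.symm.trans hx)

/-- A failure of minimality is a pair to cancel, and cancelling lowers the number of basis elements.
-/
theorem exists_isMinimal (hU : IsUpperSet U) (C : ScalarResolution K U) [Finite C.B] :
    ∃ P : ScalarResolution K U, Finite P.B ∧ P.IsMinimal ∧
      (∀ l, Odd (P.fiber l).ncard ↔ Odd (C.fiber l).ncard) ∧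
      ∀ l, C.CyclicAt l → P.CyclicAt l := by
  induction hN : Nat.card C.B using Nat.strong_induction_on generalizing C with
  | _ N ih =>
    by_cases hmin : C.IsMinimal
    · exact ⟨C, inferInstance, hmin, fun _ => Iff.rfl, fun _ h => h⟩
    · unfold IsMinimal at hmin
      push Not at hmin
      obtain ⟨b, c, hbc, hu⟩ := hmin
      have hfin : Finite (C.cancel hU b c hu hbc).B :=
        inferInstanceAs (Finite ({b, c}ᶜ : Set C.B))
      have hlt : Nat.card (C.cancel hU b c hu hbc).B < N := by
        rw [← hN]
        exact Finite.card_subtype_lt (p := (· ∈ ({b, c}ᶜ : Set C.B))) (x := b) (by simp)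
      obtain ⟨P, hP, hPmin, hodd, hcyc⟩ := ih _ hlt (C.cancel hU b c hu hbc) rfl
      exact ⟨P, hP, hPmin, fun l => (hodd l).trans (ncard_fiber_cancel hU hu hbc l),
        fun l h => hcyc l (retract_cyclicAt hU _ _ _ _ _ _ h)⟩

theorem IsMinimal.d_mem (hC : C.IsMinimal) {l : Fin n →₀ ℕ} {z : C.B →₀ K}
    (hz : z ∈ supported K K {x | C.mdeg x ≤ l}) : C.d z ∈ supported K K {x | C.mdeg x < l} := by
  refine map_mem_of_supported (fun b hb => ?_) hz
  rw [mem_supported']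
  intro c hc
  by_contra hbc
  have h1 := (deg_of_d_apply_ne_zero hbc).2
  rcases h1.lt_or_eq with h2 | h2
  · exact hc (h2.trans_le hb)
  · exact hbc (hC b c h2)

/-- By minimality the strand has zero differential. So each basis vector of the fiber agrees there
with a multiple of one vector, which cannot happen for two distinct ones. -/
theorem fiber_subsingleton (hC : C.IsMinimal) {l : Fin n →₀ ℕ} (h : C.CyclicAt l) :
    (C.fiber l).Subsingleton := by
  classical
  obtain ⟨v, hv⟩ := h
  have key : ∀ b ∈ C.fiber l, ∃ r : K, ∀ c ∈ C.fiber l, (single b (1 : K)) c = r * v c := by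
    intro b hb
    have hbl : single b (1 : K) ∈ supported K K {x | C.mdeg x ≤ l} :=
      single_mem_supported K _ (le_of_eq hb)
    obtain ⟨r, y, hy, hr⟩ := hv _ hbl (hC.d_mem hbl)
    refine ⟨r, fun c hc => ?_⟩
    have h1 := Submodule.add_mem _ hr (hC.d_mem hy)
    rw [sub_add_cancel] at h1
    have := apply_eq_zero_of_supported h1 (b := c) (fun h' => h'.ne hc)
    simpa [sub_eq_zero] using this
  intro b hb c hc
  by_contra hne
  obtain ⟨r, hr⟩ := key b hb
  obtain ⟨r', hr'⟩ := key c hc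
  have h1 := hr b hb
  have h2 := hr c hc
  have h3 := hr' c hc
  simp only [single_eq_same] at h1 h3
  rw [single_eq_of_ne (Ne.symm hne)] at h2
  rcases mul_eq_zero.1 h2.symm with h | h
  · simp [h] at h1
  · simp [h] at h3

end ScalarResolution

/-! ### Comparison of resolutions -/

namespace ScalarResolution

variable {K : Type*} [Field K] {n : ℕ} {U : Set (Fin n →₀ ℕ)} {P Q : ScalarResolution K U}

theorem d_single_eq_zero {b : P.B} (hb : P.hdeg b = 0) : P.d (single b 1) = 0 := by
  ext c
  by_contra h
  have := (deg_of_d_apply_ne_zero h).1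
  omega

theorem d_mem_of_hdeg {i : ℕ} {b : P.B} (hb : P.hdeg b = i + 1) :
    P.d (single b 1) ∈ supported K K {c | P.hdeg c = i ∧ P.mdeg c ≤ P.mdeg b} :=
  supported_mono (fun c (hc : P.hdeg c + 1 = P.hdeg b ∧ _) =>
    (⟨by omega, hc.2⟩ : P.hdeg c = i ∧ P.mdeg c ≤ P.mdeg b)) (P.d_mem b)

/-- The comparison theorem, by induction on the homological degree. A map that works below a bound
suffices, since Betti numbers are compared one degree at a time. -/
theorem exists_lift (hU : IsUpperSet U) (P Q : ScalarResolution K U) (N : ℕ) :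
    ∃ φ : (P.B →₀ K) →ₗ[K] (Q.B →₀ K),
      (∀ b, φ (single b 1) ∈
        supported K K {y | Q.hdeg y = P.hdeg b ∧ Q.mdeg y ≤ P.mdeg b}) ∧
      (∀ b, P.hdeg b < N → Q.d (φ (single b 1)) = φ (P.d (single b 1))) ∧
      ∀ b, P.hdeg b < N → P.mdeg b ∉ U → Q.ε (φ (single b 1)) = P.ε (single b 1) := by
  classical
  induction N with
  | zero => exact ⟨0, by simp, by simp, by simp⟩
  | succ N ih =>
    obtain ⟨φ, hφ, hφd, hφε⟩ := ih
    have hex : ∀ b, P.hdeg b = N → ∃ y ∈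
        supported K K {y | Q.hdeg y = P.hdeg b ∧ Q.mdeg y ≤ P.mdeg b},
        Q.d y = φ (P.d (single b 1)) ∧ (P.mdeg b ∉ U → Q.ε y = P.ε (single b 1)) := by
      intro b hb
      -- Degree zero is lifted through surjectivity of the augmentation, higher degrees through
      -- exactness.
      rcases N with _ | i
      · rw [d_single_eq_zero hb, map_zero]
        by_cases hbU : P.mdeg b ∈ U
        · exact ⟨0, Submodule.zero_mem _, map_zero _, fun h => absurd hbU h⟩
        · obtain ⟨y, hy, hε⟩ := Q.surj _ hbU
          refine ⟨P.ε (single b 1) • y, Submodule.smul_mem _ _ (by rwa [hb]), ?_, by simp [hε]⟩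
          rw [map_smul, ← smul_zero (P.ε (single b 1))]
          congr 1
          exact map_mem_of_supported (N := ⊥) (fun c hc => d_single_eq_zero hc.1) hy
      · have hdb := d_mem_of_hdeg hb
        obtain ⟨y, hy, hdy⟩ := Q.exact i (P.mdeg b) (φ (P.d (single b 1)))
          (graded_map_mem hφ (isLowerSet_Iic _) hdb)
          (by
            have := eqOn_supported (f := Q.d ∘ₗ φ) (g := φ ∘ₗ P.d)
              (fun c (hc : P.hdeg c = i ∧ _) => hφd c (by omega)) hdb
            simp only [LinearMap.comp_apply] at this
            rw [this, P.d_d, map_zero])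
          (fun hbU => by
            have := eqOn_supported (f := Q.ε ∘ₗ φ) (g := P.ε)
              (fun c (hc : P.hdeg c = i ∧ _) =>
                hφε c (by omega) fun h => hbU (hU hc.2 h)) hdb
            simp only [LinearMap.comp_apply] at this
            rw [this, P.ε_d b hbU])
        refine ⟨y, by rwa [hb], hdy, fun _ => ?_⟩
        rw [P.ε_pos b (by omega)]
        exact ε_eq_zero (D := Set.Iic (P.mdeg b)) (Nat.succ_ne_zero i) hy
    choose! y hy hdy hεy using hex
    set φ' : (P.B →₀ K) →ₗ[K] (Q.B →₀ K) :=
      linearCombination K fun b => if P.hdeg b = N then y b else φ (single b 1) with hφ'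
    have h1 : ∀ b, P.hdeg b = N → φ' (single b 1) = y b := fun b hb => by simp [hφ', hb]
    have h2 : ∀ b, P.hdeg b ≠ N → φ' (single b 1) = φ (single b 1) := fun b hb => by
      simp [hφ', hb]
    have h3 : ∀ b, P.hdeg b < N + 1 → φ' (P.d (single b 1)) = φ (P.d (single b 1)) := fun b hb =>
      eqOn_supported (fun c (hc : P.hdeg c + 1 = P.hdeg b ∧ _) => h2 c (by omega)) (P.d_mem b)
    refine ⟨φ', fun b => ?_, fun b hb => ?_, fun b hb hbU => ?_⟩
    · by_cases hbN : P.hdeg b = N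
      · rw [h1 b hbN]; exact hy b hbN
      · rw [h2 b hbN]; exact hφ b
    · rw [h3 b hb]
      by_cases hbN : P.hdeg b = N
      · rw [h1 b hbN]; exact hdy b hbN
      · rw [h2 b hbN]; exact hφd b (by omega)
    · by_cases hbN : P.hdeg b = N
      · rw [h1 b hbN]; exact hεy b hbN hbU
      · rw [h2 b hbN]; exact hφε b (by omega) hbU

/-- A chain map that induces zero on `S/M` is null-homotopic by exactness. It is applied to the
difference of a round trip between two resolutions and the identity. -/
theorem exists_homotopy {N : ℕ} {θ : (P.B →₀ K) →ₗ[K] (P.B →₀ K)}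
    (hθ : ∀ b, θ (single b 1) ∈
      supported K K {y | P.hdeg y = P.hdeg b ∧ P.mdeg y ≤ P.mdeg b})
    (hθd : ∀ b, P.hdeg b < N → P.d (θ (single b 1)) = θ (P.d (single b 1)))
    (hθε : ∀ b, P.hdeg b < N → P.mdeg b ∉ U → P.ε (θ (single b 1)) = 0) :
    ∃ h : (P.B →₀ K) →ₗ[K] (P.B →₀ K),
      (∀ b, h (single b 1) ∈
        supported K K {y | P.hdeg y = P.hdeg b + 1 ∧ P.mdeg y ≤ P.mdeg b}) ∧
      ∀ b, P.hdeg b < N → P.d (h (single b 1)) + h (P.d (single b 1)) = θ (single b 1) := by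
  classical
  induction N with
  | zero => exact ⟨0, by simp, by simp⟩
  | succ N ih =>
    obtain ⟨h, hh, hhd⟩ := ih (fun b hb => hθd b (by omega)) (fun b hb => hθε b (by omega))
    have hex : ∀ b, P.hdeg b = N → ∃ y ∈
        supported K K {y | P.hdeg y = P.hdeg b + 1 ∧ P.mdeg y ≤ P.mdeg b},
        P.d y + h (P.d (single b 1)) = θ (single b 1) := by
      intro b hb
      have hhdb : h (P.d (single b 1)) ∈
          supported K K {y | P.hdeg y = P.hdeg b ∧ P.mdeg y ≤ P.mdeg b} :=
        graded_map_mem hh (isLowerSet_Iic _) (P.d_mem b)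
      obtain ⟨y, hy, hdy⟩ := P.exact (P.hdeg b) (P.mdeg b) (θ (single b 1) - h (P.d (single b 1)))
        (Submodule.sub_mem _ (hθ b) hhdb)
        (by
          have := eqOn_supported (f := P.d ∘ₗ h + h ∘ₗ P.d) (g := θ)
            (fun c (hc : P.hdeg c + 1 = P.hdeg b ∧ _) => hhd c (by omega)) (P.d_mem b)
          simp only [LinearMap.comp_apply, LinearMap.add_apply, P.d_d, map_zero, add_zero] at this
          rw [map_sub, this, hθd b (by omega), sub_self])
        (fun hbU => by
          have : P.ε (h (P.d (single b 1))) = 0 :=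
            map_mem_of_supported (f := P.ε ∘ₗ h) (N := (⊥ : Submodule K K))
              (fun c _ => ε_eq_zero (D := Set.Iic (P.mdeg c)) (Nat.succ_ne_zero _) (hh c))
              (P.d_mem b)
          rw [map_sub, this, hθε b (by omega) hbU, sub_self])
      exact ⟨y, hy, by rw [hdy, sub_add_cancel]⟩
    choose! y hy hdy using hex
    set h' : (P.B →₀ K) →ₗ[K] (P.B →₀ K) :=
      linearCombination K fun b => if P.hdeg b = N then y b else h (single b 1) with hh'
    have h1 : ∀ b, P.hdeg b = N → h' (single b 1) = y b := fun b hb => by simp [hh', hb]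
    have h2 : ∀ b, P.hdeg b ≠ N → h' (single b 1) = h (single b 1) := fun b hb => by
      simp [hh', hb]
    have h3 : ∀ b, P.hdeg b < N + 1 → h' (P.d (single b 1)) = h (P.d (single b 1)) := fun b hb =>
      eqOn_supported (fun c (hc : P.hdeg c + 1 = P.hdeg b ∧ _) => h2 c (by omega)) (P.d_mem b)
    refine ⟨h', fun b => ?_, fun b hb => ?_⟩
    · by_cases hbN : P.hdeg b = N
      · rw [h1 b hbN]; exact hy b hbN
      · rw [h2 b hbN]; exact hh b
    · rw [h3 b hb]
      by_cases hbN : P.hdeg b = N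
      · rw [h1 b hbN]; exact hdy b hbN
      · rw [h2 b hbN]; exact hhd b (by omega)

/-- The number of basis elements of a minimal resolution in a given degree is at most the number of
those of any resolution. -/
theorem card_le_of_isMinimal (hU : IsUpperSet U) (hP : P.IsMinimal) (k : ℕ) (l : Fin n →₀ ℕ)
    [Finite {b : P.B | P.hdeg b = k ∧ P.mdeg b = l}]
    [Finite {b : Q.B | Q.hdeg b = k ∧ Q.mdeg b = l}] :
    {b : P.B | P.hdeg b = k ∧ P.mdeg b = l}.ncard ≤
      {b : Q.B | Q.hdeg b = k ∧ Q.mdeg b = l}.ncard := by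
  set I := {b : P.B | P.hdeg b = k ∧ P.mdeg b = l} with hI
  set J := {b : Q.B | Q.hdeg b = k ∧ Q.mdeg b = l} with hJ
  -- The identities hold strictly below the bound, so `k + 1` covers degree `k`.
  obtain ⟨φ, hφ, hφd, hφε⟩ := exists_lift hU P Q (k + 1)
  obtain ⟨ψ, hψ, hψd, hψε⟩ := exists_lift hU Q P (k + 1)
  obtain ⟨h, hh, hhd⟩ := exists_homotopy (P := P) (N := k + 1) (θ := ψ ∘ₗ φ - LinearMap.id)
    (fun b => Submodule.sub_mem _ (graded_map_mem hψ (isLowerSet_Iic _) (hφ b))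
      (single_mem_supported K _ ⟨rfl, Set.mem_Iic.2 le_rfl⟩))
    (fun b hb => by
      simp only [LinearMap.sub_apply, LinearMap.comp_apply, LinearMap.id_apply, map_sub]
      rw [← hφd b hb]
      congr 1
      exact eqOn_supported (f := P.d ∘ₗ ψ) (g := ψ ∘ₗ Q.d)
        (fun c (hc : Q.hdeg c = P.hdeg b ∧ _) => hψd c (by omega)) (hφ b))
    (fun b hb hbU => by
      simp only [LinearMap.sub_apply, LinearMap.comp_apply, LinearMap.id_apply, map_sub]
      rw [← hφε b hb hbU, sub_eq_zero]
      exact eqOn_supported (f := P.ε ∘ₗ ψ) (g := Q.ε)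
        (fun c (hc : Q.hdeg c = P.hdeg b ∧ _) => hψε c (by omega)
          fun h' => hbU (hU hc.2 h')) (hφ b))
  -- As `P` is minimal, the homotopy terms lie in multidegrees below `l`, so `ψ ∘ φ` is the identity
  -- modulo these. If `φ v` has no coordinate of multidegree `l`, then neither has `v`.
  have key : ∀ v ∈ supported K K I, (∀ c ∈ J, φ v c = 0) → v = 0 := by
    intro v hv hφv
    have hvle : v ∈ supported K K {b | P.hdeg b = k ∧ P.mdeg b ∈ Set.Iic l} :=
      supported_mono (fun b hb => (⟨hb.1, hb.2.le⟩ : _ ∧ _)) hv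
    have hvle' : v ∈ supported K K {b | P.mdeg b ≤ l} :=
      supported_mono (fun b (hb : b ∈ I) => hb.2.le) hv
    have h1 : φ v ∈ supported K K {y | Q.hdeg y = k ∧ Q.mdeg y ∈ Set.Iio l} := by
      have h1' := graded_map_mem hφ (isLowerSet_Iic l) hvle
      rw [mem_supported']
      intro c hc
      by_cases hcJ : c ∈ J
      · exact hφv c hcJ
      · refine apply_eq_zero_of_supported h1' fun hc' => ?_
        rcases (show Q.mdeg c ≤ l from hc'.2).lt_or_eq with h' | h'
        · exact hc ⟨hc'.1, h'⟩
        · exact hcJ ⟨hc'.1, h'⟩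
    have h2 : ψ (φ v) ∈ supported K K {y | P.mdeg y < l} :=
      supported_mono (fun _ hy => hy.2) (graded_map_mem hψ (isLowerSet_Iio l) h1)
    have h3 : P.d (h v) ∈ supported K K {y | P.mdeg y < l} :=
      hP.d_mem (supported_mono (fun _ hy => hy.2)
        (graded_map_mem (hX := fun b => P.hdeg b + 1) hh (isLowerSet_Iic l) (i := k + 1)
          (supported_mono (fun b hb => (⟨congrArg (· + 1) hb.1, hb.2⟩ : _ ∧ _)) hvle)))
    have h4 : h (P.d v) ∈ supported K K {y | P.mdeg y < l} :=
      map_mem_of_supported (fun b hb => supported_mono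
        (fun y hy => lt_of_le_of_lt hy.2 hb) (hh b)) (hP.d_mem hvle')
    have h5 : P.d (h v) + h (P.d v) = ψ (φ v) - v :=
      eqOn_supported (f := P.d ∘ₗ h + h ∘ₗ P.d) (g := ψ ∘ₗ φ - LinearMap.id)
        (fun b (hb : b ∈ I) => hhd b (by have := hb.1; omega)) hv
    have h6 : v ∈ supported K K {y | P.mdeg y < l} := by
      have : v = ψ (φ v) - (P.d (h v) + h (P.d v)) := by rw [h5, sub_sub_cancel]
      rw [this]
      exact Submodule.sub_mem _ h2 (Submodule.add_mem _ h3 h4)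
    ext b
    by_cases hb : b ∈ I
    · exact apply_eq_zero_of_supported h6 fun h' => (lt_irrefl l) (hb.2 ▸ h')
    · exact apply_eq_zero_of_supported hv hb
  have hinj : Function.Injective (lsubtypeDomain J ∘ₗ φ ∘ₗ lmapDomain K K (Subtype.val : I → P.B) :
      (I →₀ K) →ₗ[K] (J →₀ K)) := by
    rw [← LinearMap.ker_eq_bot, LinearMap.ker_eq_bot']
    intro v hv
    apply mapDomain_injective Subtype.val_injective
    rw [mapDomain_zero]
    refine key _ ?_ fun c hc => ?_
    · refine map_mem_of_supported (s := Set.univ) (f := lmapDomain K K (Subtype.val : I → P.B))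
        (fun b _ => ?_) (by simp)
      rw [lmapDomain_apply, mapDomain_single]
      exact single_mem_supported K _ b.2
    · exact DFunLike.congr_fun hv (⟨c, hc⟩ : J)
  have := Fintype.ofFinite I
  have := Fintype.ofFinite J
  have hle := LinearMap.finrank_le_finrank_of_injective hinj
  rw [Module.finrank_finsupp_self, Module.finrank_finsupp_self] at hle
  rwa [← Nat.card_coe_set_eq, ← Nat.card_coe_set_eq, Nat.card_eq_fintype_card,
    Nat.card_eq_fintype_card]

end ScalarResolution

/-! ### Multigraded components of maps of free modules -/

section Components

variable {K : Type*} [Field K] {n : ℕ} {X Y : Type*}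

/-- The component of multidegree `a` of an element of a free module whose basis element `x` has
multidegree `dX x`. -/
noncomputable def component (dX : X → Fin n →₀ ℕ) (a : Fin n →₀ ℕ) :
    (X →₀ MvPolynomial (Fin n) K) →ₗ[K] (X →₀ K) := by
  classical exact
  { toFun := fun v => onFinset v.support
      (fun x => if dX x ≤ a then MvPolynomial.coeff (a - dX x) (v x) else 0) fun x hx => by
        rw [mem_support_iff]
        intro h
        simp [h] at hx
    map_add' := fun v w => by
      ext x
      simp only [onFinset_apply, Finsupp.add_apply, MvPolynomial.coeff_add]
      split_ifs <;> simp
    map_smul' := fun r v => by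
      ext x
      simp only [onFinset_apply, Finsupp.smul_apply, MvPolynomial.coeff_smul, RingHom.id_apply]
      split_ifs <;> simp }

/-- The element of multidegree `a` with the given coefficients. -/
noncomputable def homogenize (dX : X → Fin n →₀ ℕ) (a : Fin n →₀ ℕ) :
    (X →₀ K) →ₗ[K] (X →₀ MvPolynomial (Fin n) K) := by
  classical exact
  { toFun := fun v => onFinset v.support
      (fun x => if dX x ≤ a then MvPolynomial.monomial (a - dX x) (v x) else 0) fun x hx => by
        rw [mem_support_iff]
        intro h
        simp [h] at hx
    map_add' := fun v w => by
      ext x : 1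
      simp only [onFinset_apply, Finsupp.add_apply, map_add]
      split_ifs <;> simp
    map_smul' := fun r v => by
      ext x : 1
      simp only [onFinset_apply, Finsupp.smul_apply, RingHom.id_apply, smul_eq_mul]
      split_ifs <;> simp [MvPolynomial.smul_monomial] }

variable {dX : X → Fin n →₀ ℕ} {dY : Y → Fin n →₀ ℕ} {a : Fin n →₀ ℕ}

theorem component_apply_of_le {x : X} (h : dX x ≤ a) (v : X →₀ MvPolynomial (Fin n) K) :
    component dX a v x = MvPolynomial.coeff (a - dX x) (v x) := by
  simp [component, h]

theorem component_apply_of_not_le {x : X} (h : ¬ dX x ≤ a) (v : X →₀ MvPolynomial (Fin n) K) :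
    component dX a v x = 0 := by
  simp [component, h]

theorem homogenize_apply_of_le {x : X} (h : dX x ≤ a) (v : X →₀ K) :
    homogenize dX a v x = MvPolynomial.monomial (a - dX x) (v x) := by
  simp [homogenize, h]

theorem homogenize_apply_of_not_le {x : X} (h : ¬ dX x ≤ a) (v : X →₀ K) :
    homogenize dX a v x = 0 := by
  simp [homogenize, h]

theorem component_mem (v : X →₀ MvPolynomial (Fin n) K) :
    component dX a v ∈ supported K K {x | dX x ≤ a} := by
  rw [mem_supported']
  exact fun x hx => component_apply_of_not_le hx v

theorem component_ext {v w : X →₀ MvPolynomial (Fin n) K}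
    (h : ∀ a, component dX a v = component dX a w) : v = w := by
  ext x e
  have := DFunLike.congr_fun (h (e + dX x)) x
  rwa [component_apply_of_le le_add_self, component_apply_of_le le_add_self,
    add_tsub_cancel_right] at this

theorem component_homogenize_self {v : X →₀ K} (hv : v ∈ supported K K {x | dX x ≤ a}) :
    component dX a (homogenize dX a v) = v := by
  ext x
  by_cases hx : dX x ≤ a
  · rw [component_apply_of_le hx, homogenize_apply_of_le hx]
    simp
  · rw [component_apply_of_not_le hx, apply_eq_zero_of_supported hv hx]

theorem component_homogenize_of_ne {a' : Fin n →₀ ℕ} (h : a ≠ a') (v : X →₀ K) :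
    component dX a (homogenize dX a' v) = 0 := by
  classical
  ext x
  by_cases hx : dX x ≤ a
  · rw [component_apply_of_le hx]
    by_cases hx' : dX x ≤ a'
    · rw [homogenize_apply_of_le hx', MvPolynomial.coeff_monomial, if_neg]
      · rfl
      · exact fun h' => h ((tsub_left_inj hx' hx).1 h').symm
    · rw [homogenize_apply_of_not_le hx']; simp
  · rw [component_apply_of_not_le hx]; rfl

theorem exists_component_eq_zero (v : X →₀ MvPolynomial (Fin n) K) :
    ∃ A : Finset (Fin n →₀ ℕ), ∀ a ∉ A, component dX a v = 0 := by
  classical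
  refine ⟨v.support.biUnion fun x => (v x).support.image (· + dX x), fun a ha => ?_⟩
  ext x
  by_contra h
  have hx : dX x ≤ a := by
    by_contra hx
    exact h (component_apply_of_not_le hx v)
  rw [component_apply_of_le hx] at h
  refine ha (Finset.mem_biUnion.2 ⟨x, ?_, Finset.mem_image.2 ⟨a - dX x, ?_,
    tsub_add_cancel_of_le hx⟩⟩)
  · rw [mem_support_iff]
    intro h0
    simp [h0] at h
  · exact MvPolynomial.mem_support_iff.2 h

theorem single_monomial_eq (x : X) (e : Fin n →₀ ℕ) (r : K) :
    single x (MvPolynomial.monomial e r) = homogenize dX (e + dX x) (single x r) := by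
  classical
  ext y : 1
  rcases eq_or_ne x y with rfl | hxy
  · rw [homogenize_apply_of_le le_add_self]; simp
  · rw [single_eq_of_ne hxy.symm]
    by_cases h : dX y ≤ e + dX x
    · rw [homogenize_apply_of_le h]; simp [single_eq_of_ne hxy.symm]
    · rw [homogenize_apply_of_not_le h]

theorem monomial_smul_homogenize {v : X →₀ K} (hv : v ∈ supported K K {x | dX x ≤ a})
    (e : Fin n →₀ ℕ) (r : K) :
    (MvPolynomial.monomial e r : MvPolynomial (Fin n) K) • homogenize dX a v =
      homogenize dX (e + a) (r • v) := by
  ext x : 1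
  rw [Finsupp.smul_apply, smul_eq_mul]
  by_cases hx : dX x ≤ a
  · rw [homogenize_apply_of_le hx, homogenize_apply_of_le (hx.trans le_add_self),
      MvPolynomial.monomial_mul, Finsupp.smul_apply, smul_eq_mul, add_tsub_assoc_of_le hx]
  · rw [homogenize_apply_of_not_le hx, mul_zero]
    by_cases hx' : dX x ≤ e + a
    · rw [homogenize_apply_of_le hx', Finsupp.smul_apply, apply_eq_zero_of_supported hv hx]
      simp
    · rw [homogenize_apply_of_not_le hx']

theorem linearMap_congr {W : Type*} [AddCommGroup W] [Module K W]
    {f g : (X →₀ MvPolynomial (Fin n) K) →ₗ[K] W}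
    (h : ∀ x e r, f (single x (MvPolynomial.monomial e r)) =
      g (single x (MvPolynomial.monomial e r))) (v : X →₀ MvPolynomial (Fin n) K) : f v = g v := by
  have : f = g := by
    refine Finsupp.lhom_ext' fun x => MvPolynomial.linearMap_ext fun e => ?_
    ext1
    exact h x e 1
  rw [this]

/-- The scalar matrix of a homogeneous map of multigraded free modules. -/
structure IsScalarForm (dX : X → Fin n →₀ ℕ) (dY : Y → Fin n →₀ ℕ)
    (D : (X →₀ MvPolynomial (Fin n) K) →ₗ[MvPolynomial (Fin n) K]
      (Y →₀ MvPolynomial (Fin n) K)) (d : (X →₀ K) →ₗ[K] (Y →₀ K)) : Prop where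
  mem : ∀ x, d (single x 1) ∈ supported K K {y | dY y ≤ dX x}
  eq : ∀ x, D (single x 1) = homogenize dY (dX x) (d (single x 1))

variable {D : (X →₀ MvPolynomial (Fin n) K) →ₗ[MvPolynomial (Fin n) K]
  (Y →₀ MvPolynomial (Fin n) K)} {d : (X →₀ K) →ₗ[K] (Y →₀ K)}

theorem IsScalarForm.component_map (h : IsScalarForm dX dY D d)
    (v : X →₀ MvPolynomial (Fin n) K) : component dY a (D v) = d (component dX a v) := by
  refine linearMap_congr (f := component dY a ∘ₗ D.restrictScalars K) (g := d ∘ₗ component dX a)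
    (fun x e r => ?_) v
  simp only [LinearMap.comp_apply, LinearMap.restrictScalars_apply]
  have h1 : D (single x (MvPolynomial.monomial e r)) =
      homogenize dY (e + dX x) (r • d (single x 1)) := by
    rw [← monomial_smul_homogenize (h.mem x), ← h.eq, ← map_smul, smul_single, smul_eq_mul, mul_one]
  rw [h1, single_monomial_eq (dX := dX)]
  have h2 : r • d (single x 1) ∈ supported K K {y | dY y ≤ e + dX x} :=
    Submodule.smul_mem _ _ (supported_mono
      (fun y (hy : dY y ≤ dX x) => (hy.trans le_add_self : dY y ≤ e + dX x)) (h.mem x))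
  rcases eq_or_ne a (e + dX x) with rfl | hne
  · rw [component_homogenize_self h2, component_homogenize_self
      (single_mem_supported K r (le_add_self : dX x ≤ e + dX x)), ← map_smul, smul_single, smul_eq_mul, mul_one]
  · rw [component_homogenize_of_ne hne, component_homogenize_of_ne hne, map_zero]

theorem IsScalarForm.map_eq_zero_iff (h : IsScalarForm dX dY D d)
    (v : X →₀ MvPolynomial (Fin n) K) : D v = 0 ↔ ∀ a, d (component dX a v) = 0 := by
  simp_rw [← h.component_map]
  refine ⟨fun h' a => by rw [h', map_zero], fun h' => component_ext (dX := dY) fun a => ?_⟩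
  rw [h', map_zero]

/-- The range is graded: preimages are found in each multidegree and summed over the finitely many
where `v` has a nonzero component. -/
theorem IsScalarForm.mem_range_iff (h : IsScalarForm dX dY D d)
    (v : Y →₀ MvPolynomial (Fin n) K) :
    v ∈ Set.range D ↔ ∀ a, ∃ w ∈ supported K K {x | dX x ≤ a}, d w = component dY a v := by
  constructor
  · rintro ⟨u, rfl⟩ a
    exact ⟨component dX a u, component_mem u, (h.component_map u).symm⟩
  · intro hv
    choose w hw hdw using hv
    obtain ⟨A, hA⟩ := exists_component_eq_zero (dX := dY) v
    refine ⟨∑ a ∈ A, homogenize dX a (w a), component_ext (dX := dY) fun a => ?_⟩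
    rw [h.component_map, map_sum]
    by_cases ha : a ∈ A
    · rw [Finset.sum_eq_single_of_mem a ha, component_homogenize_self (hw a), hdw]
      exact fun b _ hb => component_homogenize_of_ne hb.symm _
    · rw [Finset.sum_eq_zero, map_zero, hA a ha]
      rintro b hb
      refine component_homogenize_of_ne ?_ _
      rintro rfl
      exact ha hb

end Components

/-! ### The augmentation to `S/M` -/

section Augmentation

variable {K : Type*} [Field K] {n : ℕ} {X : Type*} {dX : X → Fin n →₀ ℕ}
  {M : Ideal (MvPolynomial (Fin n) K)}

/-- The monomials of `M`. -/
def monomials (M : Ideal (MvPolynomial (Fin n) K)) : Set (Fin n →₀ ℕ) :=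
  {a | MvPolynomial.monomial a (1 : K) ∈ M}

theorem isUpperSet_monomials : IsUpperSet (monomials M) := fun _ _ hab ha => monomial_mem_of_le ha hab

/-- The map to `S/M` with the given scalars. -/
noncomputable def augmentation (M : Ideal (MvPolynomial (Fin n) K)) (dX : X → Fin n →₀ ℕ)
    (ε : (X →₀ K) →ₗ[K] K) :
    (X →₀ MvPolynomial (Fin n) K) →ₗ[MvPolynomial (Fin n) K] (MvPolynomial (Fin n) K ⧸ M) :=
  M.mkQ ∘ₗ linearCombination _ fun x => MvPolynomial.monomial (dX x) (ε (single x 1))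

theorem coeff_augmentation (ε : (X →₀ K) →ₗ[K] K) (a : Fin n →₀ ℕ)
    (v : X →₀ MvPolynomial (Fin n) K) :
    MvPolynomial.coeff a (linearCombination (MvPolynomial (Fin n) K)
      (fun x => MvPolynomial.monomial (dX x) (ε (single x 1))) v) = ε (component dX a v) := by
  classical
  refine linearMap_congr (f := MvPolynomial.lcoeff K a ∘ₗ (linearCombination
    (MvPolynomial (Fin n) K) fun x =>
      MvPolynomial.monomial (dX x) (ε (single x 1))).restrictScalars K)
    (g := ε ∘ₗ component dX a) (fun x e r => ?_) v
  simp only [LinearMap.comp_apply, LinearMap.restrictScalars_apply, linearCombination_single,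
    MvPolynomial.lcoeff_apply, smul_eq_mul, MvPolynomial.monomial_mul, MvPolynomial.coeff_monomial]
  rw [single_monomial_eq (dX := dX)]
  split_ifs with h
  · subst h
    rw [component_homogenize_self (single_mem_supported K r (le_add_self : dX x ≤ e + dX x)),
      ← smul_eq_mul,
      ← map_smul, smul_single, smul_eq_mul, mul_one]
  · rw [component_homogenize_of_ne (Ne.symm h), map_zero]

theorem augmentation_eq_zero_iff (hM : IsMonomialIdeal M) (ε : (X →₀ K) →ₗ[K] K)
    (v : X →₀ MvPolynomial (Fin n) K) :
    augmentation M dX ε v = 0 ↔ ∀ a, a ∉ monomials M → ε (component dX a v) = 0 := by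
  rw [augmentation, LinearMap.comp_apply, Submodule.mkQ_apply, Submodule.Quotient.mk_eq_zero,
    hM.mem_iff]
  simp_rw [MvPolynomial.mem_support_iff, coeff_augmentation]
  refine forall_congr' fun a => ?_
  rw [not_imp_comm]
  rfl

theorem augmentation_surjective_iff (hM : IsMonomialIdeal M) (ε : (X →₀ K) →ₗ[K] K) :
    Function.Surjective (augmentation M dX ε) ↔
      ∀ a ∉ monomials M, ∃ v ∈ supported K K {x | dX x ≤ a}, ε v = 1 := by
  classical
  constructor
  · intro h a ha
    obtain ⟨v, hv⟩ := h (M.mkQ (MvPolynomial.monomial a 1))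
    refine ⟨component dX a v, component_mem v, ?_⟩
    rw [augmentation, LinearMap.comp_apply, ← sub_eq_zero, ← map_sub, Submodule.mkQ_apply,
      Submodule.Quotient.mk_eq_zero, hM.mem_iff] at hv
    by_contra h1
    refine ha (hv a ?_)
    rw [MvPolynomial.mem_support_iff, MvPolynomial.coeff_sub, coeff_augmentation,
      MvPolynomial.coeff_monomial, if_pos rfl, sub_ne_zero]
    exact h1
  · intro h
    rw [← LinearMap.range_eq_top, eq_top_iff]
    rintro q -
    obtain ⟨p, rfl⟩ := M.mkQ_surjective q
    -- If `1` lies in `M` the quotient is zero; otherwise a preimage of `1` in multidegree `0`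
    -- generates everything.
    by_cases h0 : (0 : Fin n →₀ ℕ) ∈ monomials M
    · have : M = ⊤ := (Ideal.eq_top_iff_one M).2 h0
      have : M.mkQ p = 0 := by
        rw [Submodule.mkQ_apply, Submodule.Quotient.mk_eq_zero, this]; trivial
      rw [this]
      exact Submodule.zero_mem _
    · obtain ⟨v, hv, hε⟩ := h 0 h0
      have : augmentation M dX ε (homogenize dX 0 v) = M.mkQ 1 := by
        rw [augmentation, LinearMap.comp_apply]
        congr 1
        ext a
        rw [coeff_augmentation, MvPolynomial.coeff_one]
        split_ifs with h'
        · rw [← h', component_homogenize_self hv, hε]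
        · rw [component_homogenize_of_ne (Ne.symm h'), map_zero]
      refine ⟨p • homogenize dX 0 v, ?_⟩
      rw [map_smul, this, ← map_smul, smul_eq_mul, mul_one]

end Augmentation

/-! ### Transport of components and supports -/

section Helpers

variable {K : Type*} [Field K] {n : ℕ} {X Y : Type*} {dX : X → Fin n →₀ ℕ} {dY : Y → Fin n →₀ ℕ}
  {M : Ideal (MvPolynomial (Fin n) K)} {a : Fin n →₀ ℕ}

theorem IsScalarForm.map_homogenize_eq_zero
    {D : (X →₀ MvPolynomial (Fin n) K) →ₗ[MvPolynomial (Fin n) K]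
      (Y →₀ MvPolynomial (Fin n) K)} {d : (X →₀ K) →ₗ[K] (Y →₀ K)}
    (h : IsScalarForm dX dY D d) {v : X →₀ K}
    (hv : v ∈ supported K K {x | dX x ≤ a}) (hdv : d v = 0) : D (homogenize dX a v) = 0 := by
  rw [h.map_eq_zero_iff]
  intro a'
  rcases eq_or_ne a' a with rfl | hne
  · rwa [component_homogenize_self hv]
  · rw [component_homogenize_of_ne hne, map_zero]

theorem augmentation_homogenize_eq_zero (hM : IsMonomialIdeal M) {ε : (X →₀ K) →ₗ[K] K}
    {v : X →₀ K} (hv : v ∈ supported K K {x | dX x ≤ a}) (hεv : a ∉ monomials M → ε v = 0) :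
    augmentation M dX ε (homogenize dX a v) = 0 := by
  rw [augmentation_eq_zero_iff hM]
  intro a' ha'
  rcases eq_or_ne a' a with rfl | hne
  · rw [component_homogenize_self hv]; exact hεv ha'
  · rw [component_homogenize_of_ne hne, map_zero]

theorem mapDomain_mem_supported {g : X → Y} {s : Set X} {t : Set Y} (h : ∀ x ∈ s, g x ∈ t)
    {v : X →₀ K} (hv : v ∈ supported K K s) : v.mapDomain g ∈ supported K K t := by
  refine map_mem_of_supported (f := lmapDomain K K g) (fun x hx => ?_) hv
  rw [lmapDomain_apply, mapDomain_single]
  exact single_mem_supported K _ (h x hx)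

theorem exists_mapDomain_eq {g : X → Y} {s : Set X} {t : Set Y} (h : ∀ y ∈ t, ∃ x ∈ s, g x = y)
    {v : Y →₀ K} (hv : v ∈ supported K K t) : ∃ w ∈ supported K K s, w.mapDomain g = v := by
  have := map_mem_of_supported (f := (LinearMap.id : (Y →₀ K) →ₗ[K] (Y →₀ K)))
    (N := (supported K K s).map (lmapDomain K K g)) (fun y hy => ?_) hv
  · exact this
  · obtain ⟨x, hx, rfl⟩ := h y hy
    exact ⟨single x 1, single_mem_supported K _ hx, by simp⟩

end Helpers

/-! ### From free resolutions to scalar ones -/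

namespace FreeResolution

variable {K : Type*} [Field K] {n : ℕ} {M : Ideal (MvPolynomial (Fin n) K)}
  (F : FreeResolution M)

/-- The scalar matrix of a differential. -/
noncomputable def scalarDiff (i : ℕ) : (F.basis (i + 1) →₀ K) →ₗ[K] (F.basis i →₀ K) :=
  linearCombination K fun b => component (F.mdeg i) (F.mdeg (i + 1) b) (F.diff i (single b 1))

theorem scalarDiff_single (i : ℕ) (b : F.basis (i + 1)) :
    F.scalarDiff i (single b 1) =
      component (F.mdeg i) (F.mdeg (i + 1) b) (F.diff i (single b 1)) := by
  simp [scalarDiff]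

theorem isScalarForm (i : ℕ) :
    IsScalarForm (F.mdeg (i + 1)) (F.mdeg i) (F.diff i) (F.scalarDiff i) where
  mem b := by
    rw [scalarDiff_single]
    exact component_mem _
  eq b := by
    rw [scalarDiff_single]
    ext c : 1
    obtain ⟨e, r, her, hdeg⟩ := F.diff_homogeneous i b c
    rw [her]
    by_cases hr : r = 0
    · subst hr
      by_cases hle : F.mdeg i c ≤ F.mdeg (i + 1) b
      · rw [homogenize_apply_of_le hle, component_apply_of_le hle, her]; simp
      · rw [homogenize_apply_of_not_le hle, map_zero]
    · have h1 := hdeg hr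
      have hle : F.mdeg i c ≤ F.mdeg (i + 1) b := by rw [← h1]; exact le_self_add
      rw [homogenize_apply_of_le hle, component_apply_of_le hle, her, ← h1, add_tsub_cancel_left]
      simp

theorem exists_aug_eq : ∃ ε : (F.basis 0 →₀ K) →ₗ[K] K, F.aug = augmentation M (F.mdeg 0) ε := by
  choose r hr using F.aug_homogeneous
  refine ⟨linearCombination K r, ?_⟩
  refine Finsupp.lhom_ext' fun b => ?_
  ext
  simp only [LinearMap.comp_apply, lsingle_apply, augmentation, linearCombination_single, one_smul]
  rw [hr]
  rfl

/-- The scalars of the augmentation. -/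
noncomputable def scalarAug : (F.basis 0 →₀ K) →ₗ[K] K := F.exists_aug_eq.choose

theorem aug_eq : F.aug = augmentation M (F.mdeg 0) F.scalarAug := F.exists_aug_eq.choose_spec

/-- The total differential on scalars. -/
noncomputable def totalDiff : ((Σ i, F.basis i) →₀ K) →ₗ[K] ((Σ i, F.basis i) →₀ K) :=
  linearCombination K fun x => match x with
    | ⟨0, _⟩ => 0
    | ⟨i + 1, b⟩ => (F.scalarDiff i (single b 1)).mapDomain (Sigma.mk i)

/-- The total augmentation on scalars. -/
noncomputable def totalAug : ((Σ i, F.basis i) →₀ K) →ₗ[K] K :=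
  linearCombination K fun x => match x with
    | ⟨0, b⟩ => F.scalarAug (single b 1)
    | ⟨_ + 1, _⟩ => 0

theorem totalDiff_zero (b : F.basis 0) : F.totalDiff (single ⟨0, b⟩ 1) = 0 := by
  simp [totalDiff]

theorem totalDiff_succ (i : ℕ) (v : F.basis (i + 1) →₀ K) :
    F.totalDiff (v.mapDomain (Sigma.mk (i + 1))) =
      (F.scalarDiff i v).mapDomain (Sigma.mk i) := by
  refine eqOn_supported (s := Set.univ) (f := F.totalDiff ∘ₗ lmapDomain K K (Sigma.mk (i + 1)))
    (g := lmapDomain K K (Sigma.mk i) ∘ₗ F.scalarDiff i) (fun b _ => ?_) (by simp)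
  simp [totalDiff]

theorem totalAug_zero (v : F.basis 0 →₀ K) :
    F.totalAug (v.mapDomain (Sigma.mk 0)) = F.scalarAug v := by
  refine eqOn_supported (s := Set.univ) (f := F.totalAug ∘ₗ lmapDomain K K (Sigma.mk 0))
    (g := F.scalarAug) (fun b _ => ?_) (by simp)
  simp [totalAug]

/-- Homogenizing `v` in multidegree `a` makes exactness over the polynomial ring applicable; the
component at `a` of a preimage is the scalar solution. -/
theorem exists_scalarDiff_zero_eq (hM : IsMonomialIdeal M) {a : Fin n →₀ ℕ} {v : F.basis 0 →₀ K}
    (hv : v ∈ supported K K {b | F.mdeg 0 b ≤ a}) (hεv : a ∉ monomials M → F.scalarAug v = 0) :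
    ∃ w ∈ supported K K {b | F.mdeg 1 b ≤ a}, F.scalarDiff 0 w = v := by
  have h1 := augmentation_homogenize_eq_zero hM hv hεv
  rw [← aug_eq] at h1
  obtain ⟨w, hw, hdw⟩ := ((F.isScalarForm 0).mem_range_iff _).1 ((F.exact_zero _).1 h1) a
  exact ⟨w, hw, by rw [hdw, component_homogenize_self hv]⟩

theorem exists_scalarDiff_succ_eq (i : ℕ) {a : Fin n →₀ ℕ} {v : F.basis (i + 1) →₀ K}
    (hv : v ∈ supported K K {b | F.mdeg (i + 1) b ≤ a}) (hdv : F.scalarDiff i v = 0) :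
    ∃ w ∈ supported K K {b | F.mdeg (i + 2) b ≤ a}, F.scalarDiff (i + 1) w = v := by
  have h1 := (F.isScalarForm i).map_homogenize_eq_zero hv hdv
  obtain ⟨w, hw, hdw⟩ := ((F.isScalarForm (i + 1)).mem_range_iff _).1 ((F.exact_succ i _).1 h1) a
  exact ⟨w, hw, by rw [hdw, component_homogenize_self hv]⟩

theorem scalarDiff_scalarDiff_single (i : ℕ) (b : F.basis (i + 2)) :
    F.scalarDiff i (F.scalarDiff (i + 1) (single b 1)) = 0 := by
  have h1 := (F.exact_succ i (F.diff (i + 1) (single b 1))).2 ⟨_, rfl⟩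
  have h2 := ((F.isScalarForm i).map_eq_zero_iff _).1 h1 (F.mdeg (i + 2) b)
  rwa [← scalarDiff_single] at h2

/-- The scalar form of a resolution. -/
noncomputable def toScalar (hM : IsMonomialIdeal M) : ScalarResolution K (monomials M) where
  B := Σ i, F.basis i
  hdeg x := x.1
  mdeg x := F.mdeg x.1 x.2
  d := F.totalDiff
  ε := F.totalAug
  d_mem := by
    rintro ⟨_ | i, b⟩
    · rw [totalDiff_zero]; exact Submodule.zero_mem _
    · have := F.totalDiff_succ i (single b 1)
      rw [mapDomain_single] at this
      rw [this]
      exact mapDomain_mem_supported (by intro c hc; exact ⟨rfl, hc⟩) ((F.isScalarForm i).mem b)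
  ε_pos := by
    rintro ⟨_ | i, b⟩ hb
    · exact absurd rfl hb
    · simp [totalAug]
  d_d v := by
    refine map_mem_of_supported (s := Set.univ) (f := F.totalDiff ∘ₗ F.totalDiff) (N := ⊥)
      ?_ (v := v) (by simp)
    rintro ⟨_ | _ | i, b⟩ -
    · simp [totalDiff_zero]
    · have := F.totalDiff_succ 0 (single b 1)
      rw [mapDomain_single] at this
      rw [Submodule.mem_bot, LinearMap.comp_apply, this]
      exact map_mem_of_supported (s := Set.univ)
        (f := F.totalDiff ∘ₗ lmapDomain K K (Sigma.mk 0)) (N := ⊥)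
        (fun c _ => by simp [totalDiff_zero]) (by simp)
    · have := F.totalDiff_succ (i + 1) (single b 1)
      rw [mapDomain_single] at this
      rw [Submodule.mem_bot, LinearMap.comp_apply, this, totalDiff_succ,
        scalarDiff_scalarDiff_single, mapDomain_zero]
  ε_d := by
    rintro ⟨_ | _ | i, b⟩ hb
    · rw [totalDiff_zero, map_zero]
    · have := F.totalDiff_succ 0 (single b 1)
      rw [mapDomain_single] at this
      rw [this, totalAug_zero]
      have h1 := (F.exact_zero (F.diff 0 (single b 1))).2 ⟨_, rfl⟩
      rw [aug_eq, augmentation_eq_zero_iff hM] at h1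
      have h2 := h1 (F.mdeg 1 b) hb
      rwa [← scalarDiff_single] at h2
    · have := F.totalDiff_succ (i + 1) (single b 1)
      rw [mapDomain_single] at this
      rw [this]
      exact map_mem_of_supported (s := Set.univ)
        (f := F.totalAug ∘ₗ lmapDomain K K (Sigma.mk (i + 1))) (N := (⊥ : Submodule K K))
        (fun c _ => by simp [totalAug]) (by simp)
  exact i a v hv hdv hεv := by
    obtain ⟨w, hw, rfl⟩ := exists_mapDomain_eq (g := Sigma.mk i) (s := {b | F.mdeg i b ≤ a})
      (by rintro ⟨_, b⟩ ⟨rfl, hb⟩; exact ⟨b, hb, rfl⟩) hv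
    have hmem : ∀ u ∈ supported K K {b | F.mdeg (i + 1) b ≤ a},
        u.mapDomain (Sigma.mk (i + 1)) ∈ supported K K
          {x : Σ i, F.basis i | x.1 = i + 1 ∧ F.mdeg x.1 x.2 ≤ a} :=
      fun u hu => mapDomain_mem_supported (by intro b hb; exact ⟨rfl, hb⟩) hu
    rcases i with _ | i
    · rw [totalAug_zero] at hεv
      obtain ⟨u, hu, hdu⟩ := F.exists_scalarDiff_zero_eq hM hw hεv
      exact ⟨_, hmem u hu, by rw [totalDiff_succ, hdu]⟩
    · rw [totalDiff_succ] at hdv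
      have hdw : F.scalarDiff i w = 0 :=
        mapDomain_injective sigma_mk_injective (by rw [hdv, mapDomain_zero])
      obtain ⟨u, hu, hdu⟩ := F.exists_scalarDiff_succ_eq i hw hdw
      exact ⟨_, hmem u hu, by rw [totalDiff_succ, hdu]⟩
  surj a ha := by
    have h := F.aug_surjective
    rw [aug_eq, augmentation_surjective_iff hM] at h
    obtain ⟨v, hv, hεv⟩ := h a ha
    exact ⟨v.mapDomain (Sigma.mk 0), mapDomain_mem_supported (by intro b hb; exact ⟨rfl, hb⟩) hv,
      by rw [totalAug_zero, hεv]⟩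

/-- A nonzero scalar between equal multidegrees comes from an entry with exponent zero, that is,
from an invertible constant. -/
theorem isMinimal_toScalar (hM : IsMonomialIdeal M) (hF : F.IsMinimal) :
    (F.toScalar hM).IsMinimal := by
  rintro ⟨i, b⟩ ⟨j, c⟩ hbc
  by_contra h
  have h1 : j + 1 = i := (ScalarResolution.deg_of_d_apply_ne_zero h).1
  subst h1
  refine h ?_
  have h2 := F.totalDiff_succ j (single b 1)
  rw [mapDomain_single] at h2
  change F.totalDiff (single ⟨j + 1, b⟩ 1) ⟨j, c⟩ = 0
  rw [h2, mapDomain_apply sigma_mk_injective, scalarDiff_single]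
  have hbc' : F.mdeg j c = F.mdeg (j + 1) b := hbc
  rw [component_apply_of_le hbc'.le, hbc', tsub_self]
  obtain ⟨e, r, her, hdeg⟩ := F.diff_homogeneous j b c
  by_contra hne
  rw [her] at hne
  have hr : r ≠ 0 := by
    rintro rfl
    simp at hne
  have he : e = 0 := by
    have := hdeg hr
    rw [hbc'] at this
    simpa using this
  refine hF j b c ?_
  rw [her, he]
  exact (isUnit_iff_ne_zero.2 hr).map MvPolynomial.C

theorem ncard_toScalar (hM : IsMonomialIdeal M) (k : ℕ) (l : Fin n →₀ ℕ) :
    {b : (F.toScalar hM).B | (F.toScalar hM).hdeg b = k ∧ (F.toScalar hM).mdeg b = l}.ncard =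
      F.betti k l := by
  have : {b : (F.toScalar hM).B | (F.toScalar hM).hdeg b = k ∧ (F.toScalar hM).mdeg b = l} =
      Sigma.mk k '' {b | F.mdeg k b = l} := by
    ext ⟨i, b⟩
    constructor
    · rintro ⟨rfl, h⟩
      exact ⟨b, h, rfl⟩
    · rintro ⟨c, hc, h⟩
      rw [← h]
      exact ⟨rfl, hc⟩
  rw [this]
  exact Set.ncard_image_of_injective _ sigma_mk_injective

theorem finite_toScalar (hM : IsMonomialIdeal M) (k : ℕ) (l : Fin n →₀ ℕ) :
    Finite {b : (F.toScalar hM).B |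
      (F.toScalar hM).hdeg b = k ∧ (F.toScalar hM).mdeg b = l} := by
  have := F.finite_basis k
  refine ((Set.finite_range (Sigma.mk k : F.basis k → Σ i, F.basis i)).subset ?_).to_subtype
  rintro ⟨i, b⟩ ⟨rfl, -⟩
  exact ⟨b, rfl⟩

end FreeResolution

/-! ### From scalar resolutions to free ones -/

namespace ScalarResolution

variable {K : Type*} [Field K] {n : ℕ} {M : Ideal (MvPolynomial (Fin n) K)}
  (P : ScalarResolution K (monomials M))

/-- The multidegrees of the basis elements of homological degree `i`. -/
def gradedMdeg (i : ℕ) (b : {b : P.B // P.hdeg b = i}) : Fin n →₀ ℕ := P.mdeg b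

/-- The differential in homological degree `i + 1`. -/
noncomputable def gradedDiff (i : ℕ) :
    ({b : P.B // P.hdeg b = i + 1} →₀ K) →ₗ[K] ({b : P.B // P.hdeg b = i} →₀ K) :=
  lcomapDomain Subtype.val Subtype.val_injective ∘ₗ P.d ∘ₗ lmapDomain K K Subtype.val

theorem mapDomain_mem_hdeg {i : ℕ} {a : Fin n →₀ ℕ} {v : {b : P.B // P.hdeg b = i} →₀ K}
    (hv : v ∈ supported K K {b | P.gradedMdeg i b ≤ a}) :
    v.mapDomain Subtype.val ∈ supported K K {b | P.hdeg b = i ∧ P.mdeg b ≤ a} :=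
  mapDomain_mem_supported (by intro b hb; exact ⟨b.2, hb⟩) hv

/-- The differential lowers the homological degree by exactly one, so restricting it to degree `i`
loses nothing. -/
theorem mapDomain_gradedDiff (i : ℕ) (v : {b : P.B // P.hdeg b = i + 1} →₀ K) :
    (P.gradedDiff i v).mapDomain Subtype.val = P.d (v.mapDomain Subtype.val) := by
  refine eqOn_supported (s := Set.univ) (f := lmapDomain K K Subtype.val ∘ₗ P.gradedDiff i)
    (g := P.d ∘ₗ lmapDomain K K Subtype.val) (fun b _ => ?_) (by simp)
  simp only [LinearMap.comp_apply, gradedDiff, lmapDomain_apply, mapDomain_single]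
  obtain ⟨w, -, hw⟩ := exists_mapDomain_eq (g := (Subtype.val : {b // P.hdeg b = i} → P.B))
    (s := Set.univ) (fun c hc => ⟨⟨c, hc.1⟩, trivial, rfl⟩) (d_mem_of_hdeg b.2)
  rw [← hw]
  congr 1
  exact leftInverse_lcomapDomain_mapDomain (R := K) _ Subtype.val_injective w

/-- The differential over the polynomial ring. -/
noncomputable def polyDiff (i : ℕ) :
    ({b : P.B // P.hdeg b = i + 1} →₀ MvPolynomial (Fin n) K) →ₗ[MvPolynomial (Fin n) K]
      ({b : P.B // P.hdeg b = i} →₀ MvPolynomial (Fin n) K) :=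
  linearCombination _ fun b => homogenize (P.gradedMdeg i) (P.mdeg b) (P.gradedDiff i (single b 1))

theorem isScalarForm (i : ℕ) : IsScalarForm (P.gradedMdeg (i + 1)) (P.gradedMdeg i) (P.polyDiff i)
    (P.gradedDiff i) where
  mem b := by
    rw [mem_supported']
    intro c hc
    have h1 := P.mapDomain_gradedDiff i (single b 1)
    rw [mapDomain_single] at h1
    have h2 := mapDomain_apply Subtype.val_injective (P.gradedDiff i (single b 1)) c
    rw [← h2, h1]
    by_contra h
    exact hc (deg_of_d_apply_ne_zero h).2
  eq b := by simp [polyDiff, gradedMdeg]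

theorem exact_gradedDiff_iff_zero (v : {b : P.B // P.hdeg b = 0} →₀ K) (a : Fin n →₀ ℕ)
    (hv : v ∈ supported K K {b | P.gradedMdeg 0 b ≤ a}) :
    (a ∉ monomials M → P.ε (v.mapDomain Subtype.val) = 0) ↔
      ∃ w ∈ supported K K {b | P.gradedMdeg 1 b ≤ a}, P.gradedDiff 0 w = v := by
  constructor
  · intro h
    obtain ⟨w, hw, hdw⟩ := P.exact 0 a _ (P.mapDomain_mem_hdeg hv)
      (map_mem_of_supported (N := ⊥) (fun b hb => d_single_eq_zero hb.1)
        (P.mapDomain_mem_hdeg hv)) h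
    obtain ⟨u, hu, rfl⟩ := exists_mapDomain_eq
      (g := (Subtype.val : {b // P.hdeg b = 1} → P.B)) (s := {b | P.gradedMdeg 1 b ≤ a})
      (fun c hc => ⟨⟨c, hc.1⟩, hc.2, rfl⟩) hw
    refine ⟨u, hu, mapDomain_injective Subtype.val_injective ?_⟩
    rw [mapDomain_gradedDiff, hdw]
  · rintro ⟨w, hw, rfl⟩ ha
    rw [mapDomain_gradedDiff]
    exact ε_d_eq_zero isUpperSet_monomials ha
      (supported_mono (fun b hb => hb.2) (P.mapDomain_mem_hdeg hw))

theorem exact_gradedDiff_iff_succ (i : ℕ) (v : {b : P.B // P.hdeg b = i + 1} →₀ K)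
    (a : Fin n →₀ ℕ) (hv : v ∈ supported K K {b | P.gradedMdeg (i + 1) b ≤ a}) :
    P.gradedDiff i v = 0 ↔
      ∃ w ∈ supported K K {b | P.gradedMdeg (i + 2) b ≤ a}, P.gradedDiff (i + 1) w = v := by
  constructor
  · intro h
    obtain ⟨w, hw, hdw⟩ := P.exact (i + 1) a _ (P.mapDomain_mem_hdeg hv)
      (by rw [← mapDomain_gradedDiff, h, mapDomain_zero])
      (fun _ => ε_eq_zero (D := Set.Iic a) (Nat.succ_ne_zero i) (P.mapDomain_mem_hdeg hv))
    obtain ⟨u, hu, rfl⟩ := exists_mapDomain_eq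
      (g := (Subtype.val : {b // P.hdeg b = i + 2} → P.B)) (s := {b | P.gradedMdeg (i + 2) b ≤ a})
      (fun c hc => ⟨⟨c, hc.1⟩, hc.2, rfl⟩) hw
    refine ⟨u, hu, mapDomain_injective Subtype.val_injective ?_⟩
    rw [mapDomain_gradedDiff, hdw]
  · rintro ⟨w, hw, rfl⟩
    refine mapDomain_injective Subtype.val_injective ?_
    rw [mapDomain_gradedDiff, mapDomain_gradedDiff, P.d_d, mapDomain_zero]

/-- The multigraded free resolution over the polynomial ring. -/
noncomputable def toFree (hM : IsMonomialIdeal M) [Finite P.B] : FreeResolution M where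
  basis i := {b : P.B // P.hdeg b = i}
  finite_basis i := inferInstance
  mdeg := P.gradedMdeg
  diff := P.polyDiff
  aug := augmentation M (P.gradedMdeg 0) (P.ε ∘ₗ lmapDomain K K Subtype.val)
  diff_homogeneous i b c := by
    rw [(P.isScalarForm i).eq]
    by_cases h : P.gradedMdeg i c ≤ P.gradedMdeg (i + 1) b
    · exact ⟨_, _, homogenize_apply_of_le h _, fun _ => add_tsub_cancel_of_le h⟩
    · exact ⟨0, 0, by rw [homogenize_apply_of_not_le h, map_zero], fun h' => absurd rfl h'⟩
  aug_homogeneous b := by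
    refine ⟨P.ε (single (b : P.B) 1), ?_⟩
    rw [augmentation, LinearMap.comp_apply, linearCombination_single, one_smul,
      LinearMap.comp_apply, lmapDomain_apply, mapDomain_single]
    rfl
  aug_surjective := by
    rw [augmentation_surjective_iff hM]
    intro a ha
    obtain ⟨v, hv, hε⟩ := P.surj a ha
    obtain ⟨u, hu, rfl⟩ := exists_mapDomain_eq
      (g := (Subtype.val : {b // P.hdeg b = 0} → P.B)) (s := {b | P.gradedMdeg 0 b ≤ a})
      (fun c hc => ⟨⟨c, hc.1⟩, hc.2, rfl⟩) hv
    exact ⟨u, hu, hε⟩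
  exact_zero v := by
    rw [(P.isScalarForm 0).mem_range_iff, augmentation_eq_zero_iff hM]
    exact forall_congr' fun a => P.exact_gradedDiff_iff_zero _ a (component_mem v)
  exact_succ i v := by
    rw [(P.isScalarForm (i + 1)).mem_range_iff, (P.isScalarForm i).map_eq_zero_iff]
    exact forall_congr' fun a => P.exact_gradedDiff_iff_succ i _ a (component_mem v)

/-- An invertible polynomial has a nonzero constant term; for a monomial entry this forces equal
multidegrees, where minimality makes the scalar zero. -/
theorem isMinimal_toFree (hM : IsMonomialIdeal M) [Finite P.B] (hP : P.IsMinimal) :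
    (P.toFree hM).IsMinimal := by
  classical
  intro i (b : {b : P.B // P.hdeg b = i + 1}) (c : {b : P.B // P.hdeg b = i}) hu
  change IsUnit (P.polyDiff i (single b 1) c) at hu
  rw [(P.isScalarForm i).eq] at hu
  by_cases h : P.gradedMdeg i c ≤ P.gradedMdeg (i + 1) b
  · rw [homogenize_apply_of_le h] at hu
    have h1 := (MvPolynomial.isUnit_iff.1 hu).1.ne_zero
    rw [MvPolynomial.coeff_monomial] at h1
    have h2 : P.gradedMdeg (i + 1) b - P.gradedMdeg i c = 0 := by
      by_contra h'
      exact h1 (if_neg h')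
    rw [if_pos h2] at h1
    refine h1 ?_
    have h3 := P.mapDomain_gradedDiff i (single b 1)
    rw [mapDomain_single] at h3
    rw [← mapDomain_apply Subtype.val_injective (P.gradedDiff i (single b 1)) c, h3]
    exact hP _ _ (le_antisymm h (tsub_eq_zero_iff_le.1 h2))
  · rw [homogenize_apply_of_not_le h] at hu
    exact not_isUnit_zero hu

end ScalarResolution

/-! ### The Taylor resolution -/

section Taylor

variable {K : Type*} [Field K] {n : ℕ} {ι : Type} [LinearOrder ι] [Fintype ι]

/-- The Taylor resolution. -/
noncomputable def taylor (K : Type*) [Field K] (f : ι → Fin n →₀ ℕ) (U : Set (Fin n →₀ ℕ))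
    (hU : ∀ a, a ∈ U ↔ ∃ g, f g ≤ a) : ScalarResolution K U where
  B := Finset ι
  hdeg := Finset.card
  mdeg s := s.sup f
  d := bd K ι
  ε := lapply ∅
  d_mem s := bd_single_mem s fun g hg => single_mem_supported K _
    ⟨Finset.card_erase_add_one hg, Finset.sup_mono (Finset.erase_subset g s)⟩
  ε_pos s hs := single_eq_of_ne fun h => hs (by rw [← h]; rfl)
  d_d := bd_bd
  ε_d s hs := by
    have : s = ∅ := by
      by_contra h
      obtain ⟨g, hg⟩ := Finset.nonempty_iff_ne_empty.2 h
      exact hs ((hU _).2 ⟨g, Finset.le_sup hg⟩)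
    subst this
    simp [bd, del_single]
  exact i a v hv hdv hεv := by
    -- In a multidegree of `M` some generator divides `a` and contracts the complex; in the others
    -- the empty symbol is the only one.
    by_cases ha : a ∈ U
    · obtain ⟨g, hg⟩ := (hU a).1 ha
      refine ⟨ins K g v, ins_mem_supported (fun s hs hgs => ?_) hv, ?_⟩
      · exact ⟨by rw [Finset.card_insert_of_notMem hgs, hs.1],
          by rw [Finset.sup_insert]; exact sup_le hg hs.2⟩
      · rw [bd_ins, hdv, map_zero, sub_zero]
    · refine ⟨0, Submodule.zero_mem _, ?_⟩
      rw [map_zero]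
      ext s
      by_cases hs : s = ∅
      · rw [hs]
        exact (hεv ha).symm
      · obtain ⟨g, hg⟩ := Finset.nonempty_iff_ne_empty.2 hs
        exact (apply_eq_zero_of_supported hv fun h =>
          ha ((hU a).2 ⟨g, (Finset.le_sup hg).trans h.2⟩)).symm
  surj a _ := ⟨single ∅ 1, single_mem_supported K _ ⟨rfl, by simp⟩, by simp⟩

theorem taylor_cyclicAt {f : ι → Fin n →₀ ℕ} {U : Set (Fin n →₀ ℕ)}
    {hU : ∀ a, a ∈ U ↔ ∃ g, f g ≤ a} {l : Fin n →₀ ℕ} (h : LcmCyclic K f Finset.univ 0 l) :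
    (taylor K f U hU).CyclicAt l := by
  have h1 : lcmDvd f Finset.univ 0 l = {s | s.sup f ≤ l} := by
    ext s; simp [lcmDvd]
  have h2 : lcmSDvd f Finset.univ 0 l = {s | s.sup f < l} := by
    ext s; simp [lcmSDvd]
  rw [LcmCyclic, h1, h2] at h
  exact h

theorem ncard_fiber_taylor {M : Ideal (MvPolynomial (Fin n) K)} {f : ι → Fin n →₀ ℕ}
    {U : Set (Fin n →₀ ℕ)} {hU : ∀ a, a ∈ U ↔ ∃ g, f g ≤ a} (hf : Function.Injective f)
    (hfM : Set.range f = minGens M) (l : Fin n →₀ ℕ) :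
    ((taylor K f U hU).fiber l).ncard = taylorCount M l := by
  classical
  have hinj : Function.Injective (Finset.image f) := Finset.image_injective hf
  change {s : Finset ι | s.sup f = l}.ncard = _
  rw [taylorCount, ← Set.ncard_coe_finset, ← Set.ncard_image_of_injective _ hinj]
  congr 1
  ext t
  simp only [Finset.coe_filter, Set.mem_ofPred_eq, taylorSymbols, Finset.mem_powerset]
  constructor
  · rintro ⟨s, hs, rfl⟩
    refine ⟨fun x hx => ?_, ?_⟩
    · obtain ⟨g, -, rfl⟩ := Finset.mem_image.1 hx
      have : f g ∈ Set.range f := ⟨g, rfl⟩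
      rwa [hfM] at this
    · rw [mdeg, Finset.sup_image]; exact hs
  · rintro ⟨ht, htl⟩
    have : (t : Set (Fin n →₀ ℕ)) ⊆ f '' Set.univ := by
      rw [Set.image_univ, hfM]; exact_mod_cast ht
    obtain ⟨s, -, rfl⟩ := Finset.subset_set_image_iff.1 this
    refine ⟨s, ?_, rfl⟩
    rw [mdeg, Finset.sup_image] at htl
    exact htl

end Taylor

/-! ### Conclusion -/

/-- A minimal resolution with at most one basis element in each multidegree gives characteristic
Betti numbers. -/
theorem hasCharacteristicBettiNumbers_of_subsingleton {K : Type*} [Field K] {n : ℕ}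
    {M : Ideal (MvPolynomial (Fin n) K)} (hM : IsMonomialIdeal M)
    (P : ScalarResolution K (monomials M)) [Finite P.B] (hP : P.IsMinimal)
    (hsub : ∀ l, (P.fiber l).Subsingleton)
    (hodd : ∀ l, Odd (P.fiber l).ncard ↔ Odd (taylorCount M l)) :
    HasCharacteristicBettiNumbers M := by
  classical
  refine ⟨⟨P.toFree hM, P.isMinimal_toFree hM hP⟩, fun F hF l => ?_⟩
  have hbetti : ∀ k, F.betti k l = {b : P.B | P.hdeg b = k ∧ P.mdeg b = l}.ncard := by
    intro k
    have := F.finite_toScalar hM k l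
    rw [← F.ncard_toScalar hM]
    exact le_antisymm
      (ScalarResolution.card_le_of_isMinimal isUpperSet_monomials (F.isMinimal_toScalar hM hF) k l)
      (ScalarResolution.card_le_of_isMinimal isUpperSet_monomials hP k l)
  simp_rw [hbetti, ← hodd]
  rcases (hsub l).eq_empty_or_singleton with h | ⟨b, hb⟩
  · have h0 : ∀ k, {b : P.B | P.hdeg b = k ∧ P.mdeg b = l} = ∅ := fun k =>
      Set.subset_empty_iff.1 (h ▸ fun b hb => hb.2)
    simp only [h0, h, Set.ncard_empty]
    simp
  · have hbl : P.mdeg b = l := by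
      have : b ∈ P.fiber l := hb ▸ rfl
      exact this
    have heq : ∀ k, {b : P.B | P.hdeg b = k ∧ P.mdeg b = l} =
        if k = P.hdeg b then {b} else ∅ := by
      intro k
      have hmem : ∀ c, P.mdeg c = l → c = b := fun c hc => by
        have : c ∈ P.fiber l := hc
        rwa [hb] at this
      ext c
      split_ifs with hk
      · constructor
        · rintro ⟨-, hc⟩
          exact hmem c hc
        · rintro rfl
          exact ⟨hk.symm, hbl⟩
      · constructor
        · rintro ⟨hck, hc⟩
          exact hk (by rw [← hck, hmem c hc])
        · rintro ⟨⟩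
    rw [hb, Set.ncard_singleton, if_pos odd_one]
    convert hasSum_ite_eq (P.hdeg b) (1 : ℕ) using 2 with k
    rw [heq]
    split_ifs <;> simp

end MonomialIdeal

theorem mainTheorem5 {K : Type*} [Field K] {n : ℕ} (M : Ideal (MvPolynomial (Fin n) K))
    (hM : MonomialIdeal.IsMonomialIdeal M)
    (hpart : MonomialIdeal.purelyNondominantPart M = 0) :
    MonomialIdeal.HasCharacteristicBettiNumbers M := by
  -- Indexing the generators by `Fin` supplies the linear order that the signs need.
  let f : Fin (MonomialIdeal.minGens M).card → Fin n →₀ ℕ :=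
    fun i => ((MonomialIdeal.minGens M).equivFin.symm i : Fin n →₀ ℕ)
  have hf : Function.Injective f :=
    Subtype.val_injective.comp (MonomialIdeal.minGens M).equivFin.symm.injective
  have hrange : Set.range f = MonomialIdeal.minGens M := by
    ext a
    constructor
    · rintro ⟨i, rfl⟩
      exact ((MonomialIdeal.minGens M).equivFin.symm i).2
    · intro ha
      exact ⟨(MonomialIdeal.minGens M).equivFin ⟨a, ha⟩, by simp [f]⟩
  have hgen : M = MonomialIdeal.ofMonomials K (Set.range f) := by
    rw [hrange, MonomialIdeal.ofMonomials_minGens hM]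
  have hU : ∀ a, a ∈ MonomialIdeal.monomials M ↔ ∃ g, f g ≤ a := by
    intro a
    change MvPolynomial.monomial a (1 : K) ∈ M ↔ _
    conv_lhs => rw [hgen]
    rw [MonomialIdeal.monomial_mem_ofMonomials, Set.exists_range_iff]
  have hfin : Finite (MonomialIdeal.taylor K f _ hU).B :=
    inferInstanceAs (Finite (Finset (Fin (MonomialIdeal.minGens M).card)))
  obtain ⟨P, hPfin, hP, hodd, hcyc⟩ := MonomialIdeal.ScalarResolution.exists_isMinimal
    MonomialIdeal.isUpperSet_monomials (MonomialIdeal.taylor K f _ hU)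
  refine MonomialIdeal.hasCharacteristicBettiNumbers_of_subsingleton hM P hP (fun l => ?_)
    fun l => ?_
  · exact MonomialIdeal.ScalarResolution.fiber_subsingleton hP (hcyc l
      (MonomialIdeal.taylor_cyclicAt
        (MonomialIdeal.lcmCyclic_of_purelyNondominantPart_eq_zero M hpart hgen l)))
  · rw [hodd, MonomialIdeal.ncard_fiber_taylor hf hrange]
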